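/- Let $n,d\ge 1$, let $f_1,\dots,f_n:\mathbb R^d\to\mathbb R$ be twice continuously differentiable, and let $x^\star$ be the minimizer of $\frac1n\sum_{i=1}^n f_i$. Let $\mu>0$, $L$, $\tilde L$ be such that for all $i$ and all $x,y\in\mathbb R^d$ $$\tfrac{\mu}{2}\|y-x\|^2\le f_i(y)-f_i(x)-\langle\nabla f_i(x),y-x\rangle\le\tfrac L2\|y-x\|^2,\qquad \|\nabla^2f_i(y)-\nabla^2f_i(x)\|\le\tilde L\|y-x\|,$$ with Euclidean norms of vectors and spectral norms of matrices. *Notation.* $X\succeq Y$ means that $X-Y$ is symmetric positive semidefinite. For $d\times d$ matrices $B,K$ put $\sigma(B,K)=\operatorname{Tr}\big((K^{-1})^{\mathsf T}(B-K)\big)$; for $u\in\mathbb R^d$ put $$\mathrm{BFGS}(B,K,u)=B-\frac{Buu^{\mathsf T}B}{\langle u,Bu\rangle}+\frac{Kuu^{\mathsf T}K}{\langle u,Ku\rangle}\quad(u\neq0),\qquad \mathrm{BFGS}(B,K,0)=B;$$ and let $\bar u(B,K)$ be any maximizer of $\langle u,Bu\rangle/\langle u,Ku\rangle$ over the standard basis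 vectors $u\in\{e_1,\dots,e_d\}$. For $t\ge1$ let $i_t=1+(t-1)\bmod n$. Put $M=\tilde L/\mu^{3/2}$. *Algorithm (SLIQN).* Given a sequence $(\alpha_k)_{k\ge0}$, a point $x^0$ and matrices $I_1^0,\dots,I_n^0$, set $z_i^0=x^0$ and $D_i^0=(1+\alpha_0)^2I_i^0$ for all $i$, and $\omega_t=(1+\alpha_{\lceil t/n\rceil})^2$ if $n\mid t$, $\omega_t=1$ otherwise. For $t\ge1$: $$x^t=\Big(\sum_{i=1}^nD_i^{t-1}\Big)^{-1}\sum_{i=1}^n\big(D_i^{t-1}z_i^{t-1}-\nabla f_i(z_i^{t-1})\big),$$ $z_{i_t}^t=x^t$; $z_i^t=z_i^{t-1}$ and $D_i^t=\omega_tD_i^{t-1}$ for $i\ne i_t$; and $$Q^t=\mathrm{BFGS}\big(D_{i_t}^{t-1},(1+\alpha_{\lceil t/n-1\rceil})K^t,z_{i_t}^t-z_{i_t}^{t-1}\big),\quad K^t=\int_0^1\nabla^2f_{i_t}\big(z_{i_t}^{t-1}+\tau(z_{i_t}^t-z_{i_t}^{t-1})\big)d\tau,$$ $$D_{i_t}^t=\omega_t\,\mathrm{BFGS}\big(Q^t,\nabla^2f_{i_t}(z_{i_t}^t),\bar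 u(Q^t,\nabla^2f_{i_t}(z_{i_t}^t))\big).$$ **Claim.** For every $\rho$ with $0<\rho<1-\frac{\mu}{dL}$ there exist $\epsilon>0$ and $\sigma_0>0$ such that the following holds. If $\|x^0-x^\star\|\le\epsilon$, and $I_i^0\succeq\nabla^2f_i(x^0)$ and $\sigma(I_i^0,\nabla^2f_i(x^0))\le\sigma_0$ for all $i$, then every sequence of iterates generated by the algorithm with $\alpha_k=M\sqrt L\,\epsilon\rho^k$ satisfies $$\|x^t-x^\star\|\le\rho^{\lceil t/n\rceil}\|x^0-x^\star\|\quad\text{for all }t\ge0,$$ and $$\sigma\big(\omega_t^{-1}D_{i_t}^t,\nabla^2f_{i_t}(z_{i_t}^t)\big)\le\Big(1-\frac{\mu}{dL}\Big)^{\lceil t/n\rceil}\delta\quad\text{for all }t\ge1,$$ where $$\delta=e^{\frac{4M\sqrt L\,\epsilon}{1-\rho}}\Big(\sigma_0+\epsilon\,\frac{4Md\sqrt L}{1-\frac{\rho}{1-\mu/(dL)}}\Big).$$ -/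

import Mathlib

open scoped Gradient

noncomputable section

namespace SLIQN

/-- The Hessian matrix of `f` at `x`, i.e. the matrix of second partial derivatives. -/
def hess {d : ℕ} (f : EuclideanSpace ℝ (Fin d) → ℝ) (x : EuclideanSpace ℝ (Fin d)) :
    Matrix (Fin d) (Fin d) ℝ :=
  Matrix.of fun i j =>
    fderiv ℝ (fderiv ℝ f) x (EuclideanSpace.single i 1) (EuclideanSpace.single j 1)

/-- The spectral norm of a matrix: the operator norm for the Euclidean norm. -/
def specNorm {d : ℕ} (A : Matrix (Fin d) (Fin d) ℝ) : ℝ :=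
  ‖Matrix.toEuclideanCLM (n := Fin d) (𝕜 := ℝ) A‖

/-- The product of a matrix with a vector of Euclidean space. -/
def app {d : ℕ} (A : Matrix (Fin d) (Fin d) ℝ) (v : EuclideanSpace ℝ (Fin d)) :
    EuclideanSpace ℝ (Fin d) :=
  Matrix.toEuclideanCLM (n := Fin d) (𝕜 := ℝ) A v

/-- `f` is `μ`-strongly convex and `L`-smooth on the whole space. -/
def StrongConvexSmooth {d : ℕ} (μ L : ℝ) (f : EuclideanSpace ℝ (Fin d) → ℝ) : Prop :=
  ∀ x y : EuclideanSpace ℝ (Fin d),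
    μ / 2 * ‖y - x‖ ^ 2 ≤ f y - f x - inner ℝ (∇ f x) (y - x) ∧
    f y - f x - inner ℝ (∇ f x) (y - x) ≤ L / 2 * ‖y - x‖ ^ 2

/-- The Hessian of `f` is `L'`-Lipschitz in the spectral norm. -/
def LipschitzHessian {d : ℕ} (L' : ℝ) (f : EuclideanSpace ℝ (Fin d) → ℝ) : Prop :=
  ∀ x y : EuclideanSpace ℝ (Fin d), specNorm (hess f y - hess f x) ≤ L' * ‖y - x‖

/-- The generalized BFGS update
`B - B u uᵀ B / ⟨u, B u⟩ + K u uᵀ K / ⟨u, K u⟩`. For `u = 0` both corrections vanish and the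
update leaves `B` unchanged. -/
def bfgs {d : ℕ} (B K : Matrix (Fin d) (Fin d) ℝ) (u : EuclideanSpace ℝ (Fin d)) :
    Matrix (Fin d) (Fin d) ℝ :=
  B - (inner ℝ u (app B u))⁻¹ • (B * Matrix.vecMulVec u u * B)
    + (inner ℝ u (app K u))⁻¹ • (K * Matrix.vecMulVec u u * K)

/-- `u` is a greedy vector of `B` with respect to `K`: a standard basis vector that maximizes
`⟨u, B u⟩ / ⟨u, K u⟩` among the standard basis vectors (ties are broken arbitrarily). -/
def IsGreedyVec {d : ℕ} (B K : Matrix (Fin d) (Fin d) ℝ) (u : EuclideanSpace ℝ (Fin d)) : Prop :=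
  ∃ i : Fin d, u = EuclideanSpace.single i 1 ∧
    ∀ v : EuclideanSpace ℝ (Fin d), (∃ j : Fin d, v = EuclideanSpace.single j 1) →
      inner ℝ v (app B v) / inner ℝ v (app K v) ≤ inner ℝ u (app B u) / inner ℝ u (app K u)

/-- The Hessian approximation error `σ(B, K) = ⟨K⁻¹, B - K⟩ = Tr((K⁻¹)ᵀ (B - K))`. -/
def sigma {d : ℕ} (B K : Matrix (Fin d) (Fin d) ℝ) : ℝ :=
  ((K⁻¹).transpose * (B - K)).trace

/-- The averaged Hessian `∫₀¹ ∇²f(a + τ (b - a)) dτ`, taken entrywise. -/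
def avgHess {d : ℕ} (f : EuclideanSpace ℝ (Fin d) → ℝ) (a b : EuclideanSpace ℝ (Fin d)) :
    Matrix (Fin d) (Fin d) ℝ :=
  Matrix.of fun i j => ∫ τ in (0 : ℝ)..1, hess f (a + τ • (b - a)) i j

/-- The cyclic index `i_t` for `t ≥ 1`. Indices run over `0, …, n - 1`, so it is
`(t - 1) mod n`. -/
def idx (n : ℕ) [NeZero n] (t : ℕ) : Fin n := Fin.ofNat n (t - 1)

/-- The scaling factor `ω_t`. -/
def omega (n : ℕ) (α : ℕ → ℝ) (t : ℕ) : ℝ :=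
  if n ∣ t then (1 + α ⌈(t : ℝ) / n⌉₊) ^ 2 else 1

/-- The matrix `Q^t`, obtained by the classical BFGS update in iteration `t ≥ 1`. -/
def classicUpdate {d n : ℕ} [NeZero n] (f : Fin n → EuclideanSpace ℝ (Fin d) → ℝ) (α : ℕ → ℝ)
    (z : ℕ → Fin n → EuclideanSpace ℝ (Fin d)) (D : ℕ → Fin n → Matrix (Fin d) (Fin d) ℝ)
    (t : ℕ) : Matrix (Fin d) (Fin d) ℝ :=
  bfgs (D (t - 1) (idx n t))
    ((1 + α ⌈(t : ℝ) / n - 1⌉₊) • avgHess (f (idx n t)) (z (t - 1) (idx n t)) (z t (idx n t)))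
    (z t (idx n t) - z (t - 1) (idx n t))

/-- `x`, `z`, `D` are the sequences generated by the sharpened lazy incremental quasi-Newton
algorithm with components `f`, scaling sequence `α`, starting point `x 0` and initial matrices
`I₀`. -/
structure IsRun {d n : ℕ} [NeZero n] (f : Fin n → EuclideanSpace ℝ (Fin d) → ℝ) (α : ℕ → ℝ)
    (I₀ : Fin n → Matrix (Fin d) (Fin d) ℝ) (x : ℕ → EuclideanSpace ℝ (Fin d))
    (z : ℕ → Fin n → EuclideanSpace ℝ (Fin d))
    (D : ℕ → Fin n → Matrix (Fin d) (Fin d) ℝ) : Prop where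
  z_zero : ∀ i, z 0 i = x 0
  D_zero : ∀ i, D 0 i = (1 + α 0) ^ 2 • I₀ i
  x_update : ∀ t, 1 ≤ t →
    x t = app (∑ i, D (t - 1) i)⁻¹
      (∑ i, (app (D (t - 1) i) (z (t - 1) i) - ∇ (f i) (z (t - 1) i)))
  z_update : ∀ t, 1 ≤ t → z t (idx n t) = x t
  z_keep : ∀ t, 1 ≤ t → ∀ i, i ≠ idx n t → z t i = z (t - 1) i
  D_keep : ∀ t, 1 ≤ t → ∀ i, i ≠ idx n t → D t i = omega n α t • D (t - 1) i
  D_update : ∀ t, 1 ≤ t → ∃ u : EuclideanSpace ℝ (Fin d),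
    IsGreedyVec (classicUpdate f α z D t) (hess (f (idx n t)) (z t (idx n t))) u ∧
    D t (idx n t) = omega n α t •
      bfgs (classicUpdate f α z D t) (hess (f (idx n t)) (z t (idx n t))) u

/-- The strong self-concordance parameter `M = L' / μ^{3/2}`. -/
def selfConc (μ L' : ℝ) : ℝ := L' / μ ^ (3 / 2 : ℝ)

/-- The scaling sequence `α_k = M √L ε ρ^k`. -/
def alpha (μ L L' ε ρ : ℝ) (k : ℕ) : ℝ := selfConc μ L' * √L * ε * ρ ^ k

/-- The constant `δ`. -/
def delta (d : ℕ) (μ L L' ε ρ σ₀ : ℝ) : ℝ :=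
  Real.exp (4 * selfConc μ L' * √L * ε / (1 - ρ)) *
    (σ₀ + ε * (4 * selfConc μ L' * d * √L / (1 - ρ / (1 - μ / (d * L)))))

end SLIQN

end

/-!
Measured by `σ(·, K)`, a BFGS update towards `K ≤ B` does not increase the error of `B`, and with
the greedy basis vector it removes the fraction `μ / (d L)` of it, because every diagonal entry
satisfies `(B - K) j j ≤ L (B j j / K j j - 1)`. The Hessians at both ends of a step agree with the
averaged Hessian up to the factor `1 + α`, so the rescaling by `(1 + α) ^ 2` restores the order
that these updates need, at the cost of a factor `(1 + α) ^ 4` on `σ + d`.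
Conversely, the Newton-type equation for `x^t` gives
`‖x^t - x*‖ ≤ (n μ)⁻¹ ∑ (L σ_i + L' ‖z_i - x*‖) ‖z_i - x*‖`, so as long as all errors are small the
distances to `x*` contract by `ρ` in each pass. The factors `α_k = O(ρ ^ k)` are then summable even
after division by `(1 - μ / (d L)) ^ k`, which in turn keeps the errors `σ_i` below the bound `δ`.
-/

namespace SLIQN

open Matrix
open scoped MatrixOrder

section LoewnerOrder

variable {ι : Type*}

theorem posDef_of_le {A B : Matrix ι ι ℝ} (hA : A.PosDef) (h : A ≤ B) : B.PosDef := by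
  simpa using hA.add_posSemidef (le_iff.mp h)

theorem isHermitian_smul_one [DecidableEq ι] (c : ℝ) : (c • (1 : Matrix ι ι ℝ)).IsHermitian :=
  isHermitian_one.smul (IsSelfAdjoint.all c)

theorem isHermitian_vecMulVec (w : ι → ℝ) : (vecMulVec w w).IsHermitian :=
  .ext fun _ _ => mul_comm _ _

variable [Fintype ι]

theorem dotProduct_mulVec_comm {A : Matrix ι ι ℝ} (hA : A.IsHermitian) (u v : ι → ℝ) :
    u ⬝ᵥ A *ᵥ v = v ⬝ᵥ A *ᵥ u := by
  rw [dotProduct_mulVec, ← mulVec_transpose, ← conjTranspose_eq_transpose_of_trivial, hA.eq,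
    dotProduct_comm]

theorem le_of_quadratic_le {A B : Matrix ι ι ℝ} (hA : A.IsHermitian) (hB : B.IsHermitian)
    (h : ∀ v : ι → ℝ, v ⬝ᵥ A *ᵥ v ≤ v ⬝ᵥ B *ᵥ v) : A ≤ B :=
  .of_dotProduct_mulVec_nonneg (hB.sub hA) fun v => by
    simpa [sub_mulVec, dotProduct_sub] using h v

theorem quadratic_le_of_le {A B : Matrix ι ι ℝ} (h : A ≤ B) (v : ι → ℝ) :
    v ⬝ᵥ A *ᵥ v ≤ v ⬝ᵥ B *ᵥ v := by
  simpa [sub_mulVec, dotProduct_sub] using (le_iff.mp h).dotProduct_mulVec_nonneg v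

theorem quadratic_nonneg {A : Matrix ι ι ℝ} (hA : A.PosSemidef) (v : ι → ℝ) :
    0 ≤ v ⬝ᵥ A *ᵥ v := by
  simpa using hA.dotProduct_mulVec_nonneg v

theorem quadratic_pos {A : Matrix ι ι ℝ} (hA : A.PosDef) {v : ι → ℝ} (hv : v ≠ 0) :
    0 < v ⬝ᵥ A *ᵥ v := by
  simpa using hA.dotProduct_mulVec_pos hv

theorem quadratic_sub_smul {A : Matrix ι ι ℝ} (hA : A.IsHermitian) (u v : ι → ℝ) (s : ℝ) :
    (v - s • u) ⬝ᵥ A *ᵥ (v - s • u) =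
      v ⬝ᵥ A *ᵥ v - 2 * s * (v ⬝ᵥ A *ᵥ u) + s ^ 2 * (u ⬝ᵥ A *ᵥ u) := by
  simp only [mulVec_sub, mulVec_smul, dotProduct_sub, sub_dotProduct, dotProduct_smul,
    smul_dotProduct, smul_eq_mul, dotProduct_mulVec_comm hA u v]
  ring

theorem sq_dotProduct_mulVec_le {A : Matrix ι ι ℝ} (hA : A.PosSemidef) (u v : ι → ℝ) :
    (v ⬝ᵥ A *ᵥ u) ^ 2 ≤ (v ⬝ᵥ A *ᵥ v) * (u ⬝ᵥ A *ᵥ u) := by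
  have hdiscrim : discrim (u ⬝ᵥ A *ᵥ u) (-2 * (v ⬝ᵥ A *ᵥ u)) (v ⬝ᵥ A *ᵥ v) ≤ 0 :=
    discrim_le_zero fun s => by
      linarith [quadratic_nonneg hA (v - s • u), quadratic_sub_smul hA.isHermitian u v s]
  rw [discrim] at hdiscrim
  linarith

theorem quadratic_sub_sq_div_le {A : Matrix ι ι ℝ} (hA : A.PosSemidef) (u v : ι → ℝ) (s : ℝ) :
    v ⬝ᵥ A *ᵥ v - (v ⬝ᵥ A *ᵥ u) ^ 2 / (u ⬝ᵥ A *ᵥ u) ≤ (v - s • u) ⬝ᵥ A *ᵥ (v - s • u) := by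
  rw [quadratic_sub_smul hA.isHermitian]
  rcases (quadratic_nonneg hA u).eq_or_lt' with hu | hu
  · have hvu : v ⬝ᵥ A *ᵥ u = 0 := by simpa [hu] using sq_dotProduct_mulVec_le hA u v
    simp [hu, hvu]
  · rw [sub_le_iff_le_add, ← sub_le_iff_le_add', le_div_iff₀ hu]
    linarith [sq_nonneg (s * (u ⬝ᵥ A *ᵥ u) - v ⬝ᵥ A *ᵥ u)]

theorem quadratic_sub_div_smul {A : Matrix ι ι ℝ} (hA : A.PosSemidef) (u v : ι → ℝ) :
    (v - ((v ⬝ᵥ A *ᵥ u) / (u ⬝ᵥ A *ᵥ u)) • u) ⬝ᵥ A *ᵥ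
        (v - ((v ⬝ᵥ A *ᵥ u) / (u ⬝ᵥ A *ᵥ u)) • u) =
      v ⬝ᵥ A *ᵥ v - (v ⬝ᵥ A *ᵥ u) ^ 2 / (u ⬝ᵥ A *ᵥ u) := by
  rw [quadratic_sub_smul hA.isHermitian]
  rcases eq_or_ne (u ⬝ᵥ A *ᵥ u) 0 with hu | hu
  · simp [hu]
  · field_simp
    ring

theorem quadratic_vecMulVec (w v : ι → ℝ) : v ⬝ᵥ vecMulVec w w *ᵥ v = (v ⬝ᵥ w) ^ 2 := by
  simp [vecMulVec_mulVec, dotProduct_comm w v, pow_two]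

theorem trace_mul_vecMulVec (A : Matrix ι ι ℝ) (u v : ι → ℝ) :
    (A * vecMulVec u v).trace = v ⬝ᵥ A *ᵥ u := by
  rw [mul_vecMulVec, trace_vecMulVec, dotProduct_comm]

theorem trace_mul_nonneg {A B : Matrix ι ι ℝ} (hA : A.PosSemidef) (hB : B.PosSemidef) :
    0 ≤ (A * B).trace := by
  classical
  obtain ⟨C, rfl⟩ := CStarAlgebra.nonneg_iff_eq_star_mul_self.mp hB.nonneg
  rw [star_eq_conjTranspose, ← Matrix.mul_assoc, trace_mul_comm, ← Matrix.mul_assoc]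
  exact (hA.mul_mul_conjTranspose_same C).trace_nonneg

theorem trace_mul_le_trace_mul {A B C : Matrix ι ι ℝ} (h : A ≤ B) (hC : C.PosSemidef) :
    (A * C).trace ≤ (B * C).trace := by
  simpa [Matrix.sub_mul] using trace_mul_nonneg (le_iff.mp h) hC

variable [DecidableEq ι]

theorem inv_mul_cancel_of_posDef {A : Matrix ι ι ℝ} (hA : A.PosDef) : A⁻¹ * A = 1 :=
  nonsing_inv_mul A ((isUnit_iff_isUnit_det A).1 hA.isUnit)

theorem mul_inv_cancel_of_posDef {A : Matrix ι ι ℝ} (hA : A.PosDef) : A * A⁻¹ = 1 :=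
  mul_nonsing_inv A ((isUnit_iff_isUnit_det A).1 hA.isUnit)

-- Both orders are Schur complements of the block matrix `[[B, 1], [1, A⁻¹]]`.
theorem inv_le_inv_of_le {A B : Matrix ι ι ℝ} (hA : A.PosDef) (h : A ≤ B) : B⁻¹ ≤ A⁻¹ := by
  have hB := posDef_of_le hA h
  let := hB.isUnit.invertible
  let := hA.inv.isUnit.invertible
  have hAA : A⁻¹⁻¹ = A := nonsing_inv_nonsing_inv A ((isUnit_iff_isUnit_det A).1 hA.isUnit)
  have hblock : (fromBlocks B 1 1ᴴ A⁻¹).PosSemidef :=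
    (PosDef.fromBlocks₂₂ B 1 hA.inv).2 (by simpa [hAA] using le_iff.mp h)
  exact le_iff.mpr (by simpa using (PosDef.fromBlocks₁₁ 1 A⁻¹ hB).1 hblock)

theorem trace_inv_mul_le_of_le_smul {A B C : Matrix ι ι ℝ} {c : ℝ} (hc : 0 < c) (hA : A.PosDef)
    (hAB : A ≤ c • B) (hC : C.PosSemidef) : (B⁻¹ * C).trace ≤ c * (A⁻¹ * C).trace := by
  have hAB' : c⁻¹ • A ≤ B := (inv_smul_le_iff_of_pos hc).2 hAB
  have hinv : (c⁻¹ • A)⁻¹ = c • A⁻¹ := inv_eq_left_inv (by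
    rw [smul_mul_smul_comm, mul_inv_cancel₀ hc.ne', inv_mul_cancel_of_posDef hA, one_smul])
  calc (B⁻¹ * C).trace ≤ ((c⁻¹ • A)⁻¹ * C).trace :=
        trace_mul_le_trace_mul (inv_le_inv_of_le (hA.smul (inv_pos.2 hc)) hAB') hC
    _ = c * (A⁻¹ * C).trace := by rw [hinv, Matrix.smul_mul, trace_smul, smul_eq_mul]

theorem quadratic_smul_one (c : ℝ) (v : ι → ℝ) :
    v ⬝ᵥ (c • (1 : Matrix ι ι ℝ)) *ᵥ v = c * (v ⬝ᵥ v) := by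
  rw [smul_mulVec, one_mulVec, dotProduct_smul, smul_eq_mul]

theorem vecMulVec_self_le_smul_one (v : ι → ℝ) :
    vecMulVec v v ≤ (v ⬝ᵥ v) • (1 : Matrix ι ι ℝ) :=
  le_of_quadratic_le (isHermitian_vecMulVec v) (isHermitian_smul_one _) fun w => by
    simpa [quadratic_vecMulVec, quadratic_smul_one, mul_comm] using
      sq_dotProduct_mulVec_le (PosSemidef.one (n := ι) (R := ℝ)) v w

theorem le_trace_smul_one {A : Matrix ι ι ℝ} (hA : A.PosSemidef) : A ≤ A.trace • 1 :=
  le_of_quadratic_le hA.isHermitian (isHermitian_smul_one _) fun v => by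
    have := trace_mul_le_trace_mul (vecMulVec_self_le_smul_one v) hA
    rwa [trace_mul_comm, trace_mul_vecMulVec, Matrix.smul_mul, Matrix.one_mul, trace_smul,
      smul_eq_mul, mul_comm, ← quadratic_smul_one] at this

end LoewnerOrder

section Bfgs

variable {d : ℕ} {B K : Matrix (Fin d) (Fin d) ℝ}

theorem inner_app (A : Matrix (Fin d) (Fin d) ℝ) (u v : EuclideanSpace ℝ (Fin d)) :
    inner ℝ u (app A v) = u.ofLp ⬝ᵥ A *ᵥ v.ofLp :=
  inner_toEuclideanCLM A u v

theorem inner_single_app (A : Matrix (Fin d) (Fin d) ℝ) (i : Fin d) :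
    inner ℝ (EuclideanSpace.single i (1 : ℝ)) (app A (EuclideanSpace.single i 1)) = A i i := by
  simp [inner_app]

theorem inner_app_pos {A : Matrix (Fin d) (Fin d) ℝ} (hA : A.PosDef)
    {u : EuclideanSpace ℝ (Fin d)} (hu : u ≠ 0) : 0 < inner ℝ u (app A u) := by
  rw [inner_app]
  exact quadratic_pos hA (by simpa using hu)

theorem mul_vecMulVec_mul {A : Matrix (Fin d) (Fin d) ℝ} (hA : A.IsHermitian) (u : Fin d → ℝ) :
    A * vecMulVec u u * A = vecMulVec (A *ᵥ u) (A *ᵥ u) := by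
  rw [mul_vecMulVec, vecMulVec_mul, ← mulVec_transpose, ← conjTranspose_eq_transpose_of_trivial,
    hA.eq]

theorem bfgs_zero (B K : Matrix (Fin d) (Fin d) ℝ) : bfgs B K 0 = B := by
  simp [bfgs]

theorem bfgs_eq (hB : B.IsHermitian) (hK : K.IsHermitian) (u : EuclideanSpace ℝ (Fin d)) :
    bfgs B K u = B - (inner ℝ u (app B u))⁻¹ • vecMulVec (B *ᵥ u.ofLp) (B *ᵥ u.ofLp)
      + (inner ℝ u (app K u))⁻¹ • vecMulVec (K *ᵥ u.ofLp) (K *ᵥ u.ofLp) := by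
  rw [bfgs, mul_vecMulVec_mul hB, mul_vecMulVec_mul hK]

theorem isHermitian_bfgs (hB : B.IsHermitian) (hK : K.IsHermitian)
    (u : EuclideanSpace ℝ (Fin d)) : (bfgs B K u).IsHermitian := by
  rw [bfgs_eq hB hK]
  exact (hB.sub ((isHermitian_vecMulVec _).smul (IsSelfAdjoint.all _))).add
    ((isHermitian_vecMulVec _).smul (IsSelfAdjoint.all _))

theorem quadratic_bfgs (hB : B.IsHermitian) (hK : K.IsHermitian) (u : EuclideanSpace ℝ (Fin d))
    (v : Fin d → ℝ) :
    v ⬝ᵥ bfgs B K u *ᵥ v =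
      v ⬝ᵥ B *ᵥ v - (v ⬝ᵥ B *ᵥ u.ofLp) ^ 2 / (u.ofLp ⬝ᵥ B *ᵥ u.ofLp)
        + (v ⬝ᵥ K *ᵥ u.ofLp) ^ 2 / (u.ofLp ⬝ᵥ K *ᵥ u.ofLp) := by
  simp only [bfgs_eq hB hK, add_mulVec, sub_mulVec, smul_mulVec, dotProduct_add, dotProduct_sub,
    dotProduct_smul, quadratic_vecMulVec, smul_eq_mul, inner_app, inv_mul_eq_div]

theorem le_bfgs (hK : K.PosSemidef) (h : K ≤ B) (u : EuclideanSpace ℝ (Fin d)) :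
    K ≤ bfgs B K u := by
  have hB : B.PosSemidef := (hK.nonneg.trans h).posSemidef
  refine le_of_quadratic_le hK.isHermitian (isHermitian_bfgs hB.isHermitian hK.isHermitian u)
    fun v => ?_
  rw [quadratic_bfgs hB.isHermitian hK.isHermitian, ← sub_le_iff_le_add,
    ← quadratic_sub_div_smul hB]
  exact (quadratic_sub_sq_div_le hK _ v _).trans (quadratic_le_of_le h _)

theorem sigma_eq_trace (hK : K.IsHermitian) : sigma B K = (K⁻¹ * (B - K)).trace := by
  rw [sigma, ← conjTranspose_eq_transpose_of_trivial, hK.inv.eq]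

theorem sigma_add_dim (hK : K.PosDef) : sigma B K + d = (K⁻¹ * B).trace := by
  rw [sigma_eq_trace hK.isHermitian, Matrix.mul_sub, inv_mul_cancel_of_posDef hK, trace_sub,
    trace_one, Fintype.card_fin, sub_add_cancel]

theorem sigma_smul (hK : K.PosDef) (c : ℝ) : sigma (c • B) K = c * (sigma B K + d) - d := by
  rw [eq_sub_iff_add_eq, sigma_add_dim hK, sigma_add_dim hK, Matrix.mul_smul, trace_smul,
    smul_eq_mul]

theorem sigma_nonneg (hK : K.PosSemidef) (h : K ≤ B) : 0 ≤ sigma B K := by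
  rw [sigma_eq_trace hK.isHermitian]
  exact trace_mul_nonneg hK.inv (le_iff.mp h)

theorem mul_sigma_le_trace_sub {μ : ℝ} (hμ : 0 < μ) (hK : μ • 1 ≤ K) (h : K ≤ B) :
    μ * sigma B K ≤ (B - K).trace := by
  have hKpos : K.PosDef := posDef_of_le (PosDef.one.smul hμ) hK
  have := trace_inv_mul_le_of_le_smul (inv_pos.2 hμ) PosDef.one
    ((le_inv_smul_iff_of_pos hμ).2 hK) (le_iff.mp h)
  rwa [inv_one, Matrix.one_mul, ← sigma_eq_trace hKpos.isHermitian, ← div_eq_inv_mul,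
    le_div_iff₀' hμ] at this

theorem trace_sub_le_mul_sigma {L : ℝ} (hL : 0 < L) (hKpos : K.PosDef) (hK : K ≤ L • 1)
    (h : K ≤ B) : (B - K).trace ≤ L * sigma B K := by
  simpa [← sigma_eq_trace hKpos.isHermitian] using
    trace_inv_mul_le_of_le_smul hL hKpos hK (le_iff.mp h)

theorem sigma_bfgs_le_sub (hK : K.PosDef) (h : K ≤ B) {u : EuclideanSpace ℝ (Fin d)}
    (hu : u ≠ 0) :
    sigma (bfgs B K u) K ≤
      sigma B K - (inner ℝ u (app B u) / inner ℝ u (app K u) - 1) := by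
  have hB := posDef_of_le hK h
  have hb := inner_app_pos hB hu
  have hk := inner_app_pos hK hu
  have hKtrace : (K⁻¹ * vecMulVec (K *ᵥ u.ofLp) (K *ᵥ u.ofLp)).trace = inner ℝ u (app K u) := by
    rw [trace_mul_vecMulVec, mulVec_mulVec, inv_mul_cancel_of_posDef hK, one_mulVec,
      dotProduct_comm, inner_app]
  have hBtrace : inner ℝ u (app B u) / inner ℝ u (app K u) ≤
      (inner ℝ u (app B u))⁻¹ * (K⁻¹ * vecMulVec (B *ᵥ u.ofLp) (B *ᵥ u.ofLp)).trace := by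
    have hCS := sq_dotProduct_mulVec_le hK.posSemidef (K⁻¹ *ᵥ B *ᵥ u.ofLp) u.ofLp
    rw [dotProduct_mulVec_comm hK.isHermitian _ u.ofLp, mulVec_mulVec _ K,
      mul_inv_cancel_of_posDef hK, one_mulVec, dotProduct_comm _ (B *ᵥ u.ofLp)] at hCS
    rw [trace_mul_vecMulVec, inv_mul_eq_div, div_le_div_iff₀ hk hb, inner_app, inner_app,
      ← pow_two, dotProduct_comm, mul_comm]
    simpa only [dotProduct_comm] using hCS
  rw [← add_le_add_iff_right (d : ℝ), sub_add_eq_add_sub, sigma_add_dim hK, sigma_add_dim hK,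
    bfgs_eq hB.isHermitian hK.isHermitian]
  simp only [Matrix.mul_add, Matrix.mul_sub, Matrix.mul_smul, trace_add, trace_sub, trace_smul,
    smul_eq_mul, hKtrace, inv_mul_cancel₀ hk.ne']
  linarith

theorem sigma_bfgs_le (hK : K.PosDef) (h : K ≤ B) (u : EuclideanSpace ℝ (Fin d)) :
    sigma (bfgs B K u) K ≤ sigma B K := by
  rcases eq_or_ne u 0 with rfl | hu
  · rw [bfgs_zero]
  have hratio : 1 ≤ inner ℝ u (app B u) / inner ℝ u (app K u) := by
    rw [one_le_div (inner_app_pos hK hu), inner_app, inner_app]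
    exact quadratic_le_of_le h _
  linarith [sigma_bfgs_le_sub hK h hu]

theorem IsGreedyVec.trace_sub_le {L : ℝ} {u : EuclideanSpace ℝ (Fin d)} (hu : IsGreedyVec B K u)
    (hKpos : K.PosDef) (hK : K ≤ L • 1) (h : K ≤ B) :
    (B - K).trace ≤ d * L * (inner ℝ u (app B u) / inner ℝ u (app K u) - 1) := by
  obtain ⟨i, rfl, hmax⟩ := hu
  set r := inner ℝ (EuclideanSpace.single i (1 : ℝ)) (app B (EuclideanSpace.single i 1)) /
    inner ℝ (EuclideanSpace.single i (1 : ℝ)) (app K (EuclideanSpace.single i 1)) with hr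
  have hdiag (j : Fin d) : 0 < K j j ∧ K j j ≤ B j j ∧ K j j ≤ L := by
    have hLK := (le_iff.mp hK).diag_nonneg (i := j)
    have hBK := (le_iff.mp h).diag_nonneg (i := j)
    simp only [Matrix.sub_apply, Matrix.smul_apply, one_apply_eq, smul_eq_mul, mul_one,
      sub_nonneg] at hLK hBK
    exact ⟨hKpos.diag_pos, hBK, hLK⟩
  have hr1 : 0 ≤ r - 1 := by
    rw [sub_nonneg, hr, inner_single_app, inner_single_app, one_le_div (hdiag i).1]
    exact (hdiag i).2.1
  have hentry (j : Fin d) : (B - K) j j ≤ L * (r - 1) :=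
    calc (B - K) j j = (B j j / K j j - 1) * K j j := by
          rw [sub_mul, div_mul_cancel₀ _ (hdiag j).1.ne', one_mul, Matrix.sub_apply]
      _ ≤ (r - 1) * K j j := by
          have := hmax _ ⟨j, rfl⟩
          rw [inner_single_app, inner_single_app] at this
          gcongr
          exact (hdiag j).1.le
      _ ≤ L * (r - 1) := by
          rw [mul_comm]
          gcongr
          exact (hdiag j).2.2
  calc (B - K).trace ≤ ∑ _j : Fin d, L * (r - 1) := Finset.sum_le_sum fun j _ => hentry j
    _ = d * L * (r - 1) := by simp [mul_assoc]

theorem IsGreedyVec.sigma_bfgs_le {μ L : ℝ} {u : EuclideanSpace ℝ (Fin d)}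
    (hu : IsGreedyVec B K u) (hμ : 0 < μ) (hμK : μ • 1 ≤ K) (hKL : K ≤ L • 1) (h : K ≤ B) :
    sigma (bfgs B K u) K ≤ (1 - μ / (d * L)) * sigma B K := by
  have hK : K.PosDef := posDef_of_le (PosDef.one.smul hμ) hμK
  obtain ⟨i, rfl, -⟩ := id hu
  have hL : 0 < L := by
    have : μ ≤ L := by simpa using (le_iff.mp (hμK.trans hKL)).diag_nonneg (i := i)
    linarith
  have hd : (0 : ℝ) < d := by exact_mod_cast i.pos
  have hgain := (mul_sigma_le_trace_sub hμ hμK h).trans (hu.trace_sub_le hK hKL h)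
  rw [← div_le_iff₀' (by positivity), mul_div_right_comm] at hgain
  linarith [sigma_bfgs_le_sub hK h (u := EuclideanSpace.single i 1) (by simp)]

/-- `A` and `B` agree up to the relative factor `c` in the Loewner order. -/
structure RelClose (c : ℝ) (A B : Matrix (Fin d) (Fin d) ℝ) : Prop where
  le_smul : A ≤ c • B
  le_smul_symm : B ≤ c • A

theorem RelClose.posDef {c : ℝ} (hc : 0 < c) {A B : Matrix (Fin d) (Fin d) ℝ}
    (h : RelClose c A B) (hB : B.PosDef) : A.PosDef :=
  posDef_of_le (hB.smul (inv_pos.2 hc)) ((inv_smul_le_iff_of_pos hc).2 h.le_smul_symm)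

theorem relClose_of_abs_quadratic_sub_le {μ c : ℝ} (hc : 0 ≤ c)
    {A B : Matrix (Fin d) (Fin d) ℝ} (hA : A.IsHermitian) (hB : B.IsHermitian) (hμA : μ • 1 ≤ A)
    (hμB : μ • 1 ≤ B)
    (h : ∀ v : Fin d → ℝ, |v ⬝ᵥ A *ᵥ v - v ⬝ᵥ B *ᵥ v| ≤ c * (μ * (v ⬝ᵥ v))) :
    RelClose (1 + c) A B := by
  have hscale {C : Matrix (Fin d) (Fin d) ℝ} (hμC : μ • 1 ≤ C) (v : Fin d → ℝ) :
      c * (μ * (v ⬝ᵥ v)) ≤ c * (v ⬝ᵥ C *ᵥ v) := by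
    have := quadratic_le_of_le hμC v
    rw [quadratic_smul_one] at this
    gcongr
  constructor
  · refine le_of_quadratic_le hA (hB.smul (IsSelfAdjoint.all _)) fun v => ?_
    rw [smul_mulVec, dotProduct_smul, smul_eq_mul]
    linarith [(abs_le.1 (h v)).2, hscale hμB v]
  · refine le_of_quadratic_le hB (hA.smul (IsSelfAdjoint.all _)) fun v => ?_
    rw [smul_mulVec, dotProduct_smul, smul_eq_mul]
    linarith [(abs_le.1 (h v)).1, hscale hμA v]

theorem RelClose.smul_le_sq_smul {c : ℝ} (hc : 0 < c) {H : Matrix (Fin d) (Fin d) ℝ}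
    (hH : RelClose c H K) (hHB : H ≤ B) : c • K ≤ c ^ 2 • B := by
  rw [pow_two, mul_smul]
  exact smul_le_smul_of_nonneg_left
    (hH.le_smul_symm.trans (smul_le_smul_of_nonneg_left hHB hc.le)) hc.le

theorem RelClose.le_bfgs {c : ℝ} (hc : 0 < c) {H H' : Matrix (Fin d) (Fin d) ℝ}
    (hK : K.PosDef) (hH : RelClose c H K) (hH' : RelClose c H' K) (hHB : H ≤ B)
    (u : EuclideanSpace ℝ (Fin d)) : H' ≤ bfgs (c ^ 2 • B) (c • K) u :=
  hH'.le_smul.trans (SLIQN.le_bfgs (hK.smul hc).posSemidef (hH.smul_le_sq_smul hc hHB) u)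

theorem RelClose.sigma_bfgs_add_dim_le {c : ℝ} (hc : 0 < c) {H H' : Matrix (Fin d) (Fin d) ℝ}
    (hK : K.PosDef) (hH : RelClose c H K) (hH' : RelClose c H' K) (hHB : H ≤ B)
    (u : EuclideanSpace ℝ (Fin d)) :
    sigma (bfgs (c ^ 2 • B) (c • K) u) H' + d ≤ c ^ 4 * (sigma B H + d) := by
  have hHpos := hH.posDef hc hK
  have hcK := hK.smul hc
  have hcKB := hH.smul_le_sq_smul hc hHB
  have hQ := posDef_of_le hcK (SLIQN.le_bfgs hcK.posSemidef hcKB u)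
  have hcKH' : c • K ≤ c ^ 2 • H' := by
    rw [pow_two, mul_smul]
    exact smul_le_smul_of_nonneg_left hH'.le_smul_symm hc.le
  rw [sigma_add_dim (hH'.posDef hc hK), sigma_add_dim hHpos]
  calc (H'⁻¹ * bfgs (c ^ 2 • B) (c • K) u).trace
      ≤ c ^ 2 * ((c • K)⁻¹ * bfgs (c ^ 2 • B) (c • K) u).trace :=
        trace_inv_mul_le_of_le_smul (by positivity) hcK hcKH' hQ.posSemidef
    _ ≤ c ^ 2 * ((c • K)⁻¹ * (c ^ 2 • B)).trace := by
        rw [← sigma_add_dim hcK, ← sigma_add_dim hcK]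
        gcongr
        exact sigma_bfgs_le hcK hcKB u
    _ ≤ c ^ 2 * (1 * (H⁻¹ * (c ^ 2 • B)).trace) := by
        gcongr
        refine trace_inv_mul_le_of_le_smul one_pos hHpos ?_ (posDef_of_le hcK hcKB).posSemidef
        rw [one_smul]
        exact hH.le_smul
    _ = c ^ 4 * (H⁻¹ * B).trace := by
        rw [Matrix.mul_smul, trace_smul, smul_eq_mul]
        ring

end Bfgs

section EuclideanAction

variable {d : ℕ}

theorem dotProduct_self_eq_norm_sq (v : EuclideanSpace ℝ (Fin d)) :
    v.ofLp ⬝ᵥ v.ofLp = ‖v‖ ^ 2 := by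
  rw [EuclideanSpace.real_norm_sq_eq, dotProduct]
  exact Finset.sum_congr rfl fun i _ => (pow_two _).symm

theorem specNorm_le_trace {P : Matrix (Fin d) (Fin d) ℝ} (hP : P.PosSemidef) :
    specNorm P ≤ P.trace := by
  have hsymm : (toEuclideanCLM (n := Fin d) (𝕜 := ℝ) P).IsSymmetric :=
    isSymmetric_toEuclideanLin_iff.2 hP.isHermitian
  rw [specNorm, ContinuousLinearMap.norm_eq_iSup_rayleighQuotient _ hsymm]
  refine ciSup_le fun v => ?_
  have hv : (toEuclideanCLM (n := Fin d) (𝕜 := ℝ) P).reApplyInnerSelf v =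
      v.ofLp ⬝ᵥ P *ᵥ v.ofLp := by
    rw [← inner_app, real_inner_comm]
    rfl
  rw [ContinuousLinearMap.rayleighQuotient, hv,
    abs_of_nonneg (div_nonneg (quadratic_nonneg hP _) (sq_nonneg _))]
  refine div_le_of_le_mul₀ (sq_nonneg _) hP.trace_nonneg ?_
  simpa only [quadratic_smul_one, dotProduct_self_eq_norm_sq] using
    quadratic_le_of_le (le_trace_smul_one hP) v.ofLp

theorem norm_app_le (A : Matrix (Fin d) (Fin d) ℝ) (v : EuclideanSpace ℝ (Fin d)) :
    ‖app A v‖ ≤ specNorm A * ‖v‖ :=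
  ContinuousLinearMap.le_opNorm _ v

theorem abs_quadratic_le (A : Matrix (Fin d) (Fin d) ℝ) (v : EuclideanSpace ℝ (Fin d)) :
    |v.ofLp ⬝ᵥ A *ᵥ v.ofLp| ≤ specNorm A * ‖v‖ ^ 2 := by
  rw [← inner_app]
  calc |inner ℝ v (app A v)| ≤ ‖v‖ * ‖app A v‖ := abs_real_inner_le_norm _ _
    _ ≤ ‖v‖ * (specNorm A * ‖v‖) := by gcongr; exact norm_app_le A v
    _ = specNorm A * ‖v‖ ^ 2 := by ring

theorem app_sub (A : Matrix (Fin d) (Fin d) ℝ) (v w : EuclideanSpace ℝ (Fin d)) :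
    app A (v - w) = app A v - app A w :=
  map_sub (toEuclideanCLM (n := Fin d) (𝕜 := ℝ) A) v w

theorem sub_app (A B : Matrix (Fin d) (Fin d) ℝ) (v : EuclideanSpace ℝ (Fin d)) :
    app (A - B) v = app A v - app B v := by
  simp [app]

theorem sum_app {ι : Type*} (s : Finset ι) (A : ι → Matrix (Fin d) (Fin d) ℝ)
    (v : EuclideanSpace ℝ (Fin d)) : app (∑ i ∈ s, A i) v = ∑ i ∈ s, app (A i) v := by
  simp [app, _root_.sum_apply]

theorem app_inv_app {A : Matrix (Fin d) (Fin d) ℝ} (hA : A.PosDef)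
    (w : EuclideanSpace ℝ (Fin d)) : app A (app A⁻¹ w) = w := by
  rw [app, app, ← mul_apply_eq_comp, ← map_mul, mul_inv_cancel_of_posDef hA]
  simp

theorem app_inv_self {A : Matrix (Fin d) (Fin d) ℝ} (hA : A.PosDef)
    (w : EuclideanSpace ℝ (Fin d)) : app A⁻¹ (app A w) = w := by
  rw [app, app, ← mul_apply_eq_comp, ← map_mul, inv_mul_cancel_of_posDef hA]
  simp

theorem mul_norm_app_inv_le {c : ℝ} (hc : 0 < c) {A : Matrix (Fin d) (Fin d) ℝ}
    (hA : c • 1 ≤ A) (w : EuclideanSpace ℝ (Fin d)) : c * ‖app A⁻¹ w‖ ≤ ‖w‖ := by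
  have h := quadratic_le_of_le hA (app A⁻¹ w).ofLp
  rw [quadratic_smul_one, dotProduct_self_eq_norm_sq, ← inner_app,
    app_inv_app (posDef_of_le (PosDef.one.smul hc) hA)] at h
  rcases (norm_nonneg (app A⁻¹ w)).eq_or_lt with h0 | h0
  · simp [← h0]
  · refine le_of_mul_le_mul_left ?_ h0
    linarith [real_inner_le_norm (app A⁻¹ w) w]

end EuclideanAction

section Hessian

variable {d : ℕ} {f : EuclideanSpace ℝ (Fin d) → ℝ}

theorem dotProduct_hess_mulVec (x u v : EuclideanSpace ℝ (Fin d)) :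
    u.ofLp ⬝ᵥ hess f x *ᵥ v.ofLp = fderiv ℝ (fderiv ℝ f) x u v := by
  have hbasis (w : EuclideanSpace ℝ (Fin d)) :
      ∑ i, w i • EuclideanSpace.single i (1 : ℝ) = w := by
    simpa using (EuclideanSpace.basisFun (Fin d) ℝ).sum_repr w
  conv_rhs => rw [← hbasis u, ← hbasis v]
  simp only [map_sum, map_smul, _root_.sum_apply, _root_.smul_apply, dotProduct, mulVec, hess,
    of_apply, smul_eq_mul, Finset.mul_sum]
  rw [Finset.sum_comm]
  exact Finset.sum_congr rfl fun i _ => Finset.sum_congr rfl fun j _ => by ring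

theorem isHermitian_hess (hf : ContDiff ℝ 2 f) (x : EuclideanSpace ℝ (Fin d)) :
    (hess f x).IsHermitian := by
  ext i j
  simpa [hess] using (hf.contDiffAt.isSymmSndFDerivAt (by simp)) _ _

theorem continuous_hess (hf : ContDiff ℝ 2 f) : Continuous (hess f) := by
  have hfderiv : Continuous (fderiv ℝ (fderiv ℝ f)) :=
    (hf.fderiv_right (m := 1) (by norm_num)).continuous_fderiv (by norm_num)
  exact continuous_matrix fun i j =>
    (hfderiv.clm_apply continuous_const).clm_apply continuous_const

theorem hasFDerivAt_gradient (hf : ContDiff ℝ 2 f) (x : EuclideanSpace ℝ (Fin d)) :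
    HasFDerivAt (∇ f) (toEuclideanCLM (n := Fin d) (𝕜 := ℝ) (hess f x)) x := by
  have hfderiv : HasFDerivAt (fderiv ℝ f) (fderiv ℝ (fderiv ℝ f) x) x :=
    ((hf.fderiv_right (m := 1) (by norm_num)).differentiable (by norm_num) x).hasFDerivAt
  refine ((InnerProductSpace.toDual ℝ
    _).symm.toContinuousLinearEquiv.hasFDerivAt.comp x hfderiv).congr_fderiv ?_
  ext1 v
  refine ext_inner_left ℝ fun u => ?_
  rw [inner_toEuclideanCLM, dotProduct_hess_mulVec,
    (hf.contDiffAt.isSymmSndFDerivAt (by simp)) u v, real_inner_comm]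
  exact InnerProductSpace.toDual_symm_apply

theorem StrongConvexSmooth.inner_gradient_sub_mem_Icc {μ L : ℝ} (h : StrongConvexSmooth μ L f)
    (x y : EuclideanSpace ℝ (Fin d)) :
    inner ℝ (y - x) (∇ f y - ∇ f x) ∈ Set.Icc (μ * ‖y - x‖ ^ 2) (L * ‖y - x‖ ^ 2) := by
  obtain ⟨hlower, hupper⟩ := h x y
  obtain ⟨hlower', hupper'⟩ := h y x
  rw [← neg_sub y x, inner_neg_right, norm_neg] at hlower' hupper'
  rw [real_inner_comm, inner_sub_left]
  constructor <;> linarith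

theorem StrongConvexSmooth.le (hd : 0 < d) {μ L : ℝ} (h : StrongConvexSmooth μ L f) : μ ≤ L := by
  have := h 0 (EuclideanSpace.single ⟨0, hd⟩ 1)
  simp only [sub_zero, PiLp.norm_single, norm_one, one_pow, mul_one] at this
  linarith

theorem LipschitzHessian.nonneg (hd : 0 < d) {L' : ℝ} (h : LipschitzHessian L' f) : 0 ≤ L' := by
  have := h 0 (EuclideanSpace.single ⟨0, hd⟩ 1)
  simp only [sub_zero, PiLp.norm_single, norm_one, mul_one] at this
  exact (norm_nonneg _).trans this

theorem quadratic_hess_mem_Icc {μ L : ℝ} (hf : ContDiff ℝ 2 f) (h : StrongConvexSmooth μ L f)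
    (x v : EuclideanSpace ℝ (Fin d)) :
    v.ofLp ⬝ᵥ hess f x *ᵥ v.ofLp ∈ Set.Icc (μ * ‖v‖ ^ 2) (L * ‖v‖ ^ 2) := by
  have hline : HasDerivAt (fun s : ℝ => x + s • v) v 0 := by
    simpa using ((hasDerivAt_id (0 : ℝ)).smul_const v).const_add x
  have hderiv : HasDerivAt (fun s : ℝ => inner ℝ v (∇ f (x + s • v)))
      (v.ofLp ⬝ᵥ hess f x *ᵥ v.ofLp) 0 := by
    have hgrad := (hasFDerivAt_gradient hf (x + (0 : ℝ) • v)).comp_hasDerivAt 0 hline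
    simpa [inner_toEuclideanCLM] using (hasDerivAt_const (0 : ℝ) v).inner ℝ hgrad
  refine isClosed_Icc.mem_of_tendsto hderiv.tendsto_slope ?_
  filter_upwards [self_mem_nhdsWithin] with s (hs : s ≠ 0)
  have hslope : slope (fun s : ℝ => inner ℝ v (∇ f (x + s • v))) 0 s =
      inner ℝ (s • v) (∇ f (x + s • v) - ∇ f x) / s ^ 2 := by
    rw [slope_def_field, zero_smul, add_zero, sub_zero, inner_smul_left, inner_sub_right]
    simp only [conj_trivial]
    field_simp
  obtain ⟨hlower, hupper⟩ := h.inner_gradient_sub_mem_Icc x (x + s • v)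
  rw [add_sub_cancel_left, norm_smul, mul_pow, Real.norm_eq_abs, sq_abs] at hlower hupper
  have hs2 : 0 < s ^ 2 := by positivity
  rw [hslope, Set.mem_Icc, le_div_iff₀ hs2, div_le_iff₀ hs2]
  constructor <;> linarith

theorem smul_one_le_hess {μ L : ℝ} (hf : ContDiff ℝ 2 f) (h : StrongConvexSmooth μ L f)
    (x : EuclideanSpace ℝ (Fin d)) : μ • 1 ≤ hess f x :=
  le_of_quadratic_le (isHermitian_smul_one μ) (isHermitian_hess hf x) fun v => by
    simpa only [quadratic_smul_one, ← dotProduct_self_eq_norm_sq] using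
      (quadratic_hess_mem_Icc hf h x (WithLp.toLp 2 v)).1

theorem hess_le_smul_one {μ L : ℝ} (hf : ContDiff ℝ 2 f) (h : StrongConvexSmooth μ L f)
    (x : EuclideanSpace ℝ (Fin d)) : hess f x ≤ L • 1 :=
  le_of_quadratic_le (isHermitian_hess hf x) (isHermitian_smul_one L) fun v => by
    simpa only [quadratic_smul_one, ← dotProduct_self_eq_norm_sq] using
      (quadratic_hess_mem_Icc hf h x (WithLp.toLp 2 v)).2

theorem norm_app_hess_sub_gradient_sub_le {L' : ℝ} (hL' : 0 ≤ L') (hf : ContDiff ℝ 2 f)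
    (h : LipschitzHessian L' f) (x y : EuclideanSpace ℝ (Fin d)) :
    ‖app (hess f y) (y - x) - (∇ f y - ∇ f x)‖ ≤ L' * ‖y - x‖ ^ 2 := by
  rw [norm_sub_rev, pow_two, ← mul_assoc]
  refine (convex_segment x y).norm_image_sub_le_of_norm_hasFDerivWithin_le'
    (fun w _ => (hasFDerivAt_gradient hf w).hasFDerivWithinAt) (fun w hw => ?_)
    (left_mem_segment ℝ x y) (right_mem_segment ℝ x y)
  rw [← map_sub]
  refine (h y w).trans ?_
  gcongr
  rw [norm_sub_rev y x]
  exact norm_sub_le_of_mem_segment (segment_symm ℝ x y ▸ hw)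

theorem quadratic_integral {A : ℝ → Matrix (Fin d) (Fin d) ℝ} (hA : Continuous A) (a b : ℝ)
    (v : Fin d → ℝ) :
    v ⬝ᵥ (Matrix.of fun i j => ∫ τ in a..b, A τ i j) *ᵥ v = ∫ τ in a..b, v ⬝ᵥ A τ *ᵥ v := by
  have hentry (i j : Fin d) : Continuous fun τ => v i * (A τ i j * v j) :=
    continuous_const.mul ((hA.matrix_elem i j).mul continuous_const)
  simp only [dotProduct, mulVec, Finset.mul_sum, of_apply]
  rw [intervalIntegral.integral_finsetSum fun i _ =>
    (continuous_finsetSum _ fun j _ => hentry i j).intervalIntegrable _ _]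
  refine Finset.sum_congr rfl fun i _ => ?_
  rw [intervalIntegral.integral_finsetSum fun j _ => (hentry i j).intervalIntegrable _ _]
  refine Finset.sum_congr rfl fun j _ => ?_
  rw [intervalIntegral.integral_const_mul, intervalIntegral.integral_mul_const]

theorem continuous_hess_lineMap (hf : ContDiff ℝ 2 f) (a b : EuclideanSpace ℝ (Fin d)) :
    Continuous fun τ : ℝ => hess f (a + τ • (b - a)) :=
  (continuous_hess hf).comp (by fun_prop)

theorem quadratic_avgHess (hf : ContDiff ℝ 2 f) (a b : EuclideanSpace ℝ (Fin d))
    (v : Fin d → ℝ) :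
    v ⬝ᵥ avgHess f a b *ᵥ v = ∫ τ in (0 : ℝ)..1, v ⬝ᵥ hess f (a + τ • (b - a)) *ᵥ v :=
  quadratic_integral (continuous_hess_lineMap hf a b) 0 1 v

theorem intervalIntegrable_quadratic_hess (hf : ContDiff ℝ 2 f)
    (a b : EuclideanSpace ℝ (Fin d)) (v : Fin d → ℝ) :
    IntervalIntegrable (fun τ : ℝ => v ⬝ᵥ hess f (a + τ • (b - a)) *ᵥ v)
      MeasureTheory.volume 0 1 :=
  (continuous_const.dotProduct
    ((continuous_hess_lineMap hf a b).matrix_mulVec continuous_const)).intervalIntegrable 0 1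

theorem avgHess_comm (a b : EuclideanSpace ℝ (Fin d)) : avgHess f a b = avgHess f b a := by
  ext i j
  have hreflect := intervalIntegral.integral_comp_sub_left (a := 0) (b := 1)
    (fun τ : ℝ => hess f (a + τ • (b - a)) i j) 1
  simp only [sub_zero, sub_self] at hreflect
  rw [avgHess, avgHess, of_apply, of_apply, ← hreflect]
  refine intervalIntegral.integral_congr fun τ _ => ?_
  rw [show a + (1 - τ) • (b - a) = b + τ • (a - b) by module]

theorem isHermitian_avgHess (hf : ContDiff ℝ 2 f) (a b : EuclideanSpace ℝ (Fin d)) :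
    (avgHess f a b).IsHermitian := by
  ext i j
  exact intervalIntegral.integral_congr fun τ _ => (isHermitian_hess hf _).apply i j

theorem smul_one_le_avgHess {μ L : ℝ} (hf : ContDiff ℝ 2 f) (h : StrongConvexSmooth μ L f)
    (a b : EuclideanSpace ℝ (Fin d)) : μ • 1 ≤ avgHess f a b :=
  le_of_quadratic_le (isHermitian_smul_one μ) (isHermitian_avgHess hf a b) fun v => by
    rw [quadratic_avgHess hf]
    simpa using intervalIntegral.integral_mono_on zero_le_one intervalIntegrable_const
      (intervalIntegrable_quadratic_hess hf a b v)
      fun τ _ => quadratic_le_of_le (smul_one_le_hess hf h _) v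

theorem abs_quadratic_avgHess_sub_le {L' : ℝ} (hf : ContDiff ℝ 2 f) (h : LipschitzHessian L' f)
    (a b : EuclideanSpace ℝ (Fin d)) (v : Fin d → ℝ) :
    |v ⬝ᵥ avgHess f a b *ᵥ v - v ⬝ᵥ hess f a *ᵥ v| ≤ L' * ‖b - a‖ / 2 * (v ⬝ᵥ v) := by
  have hdiff : v ⬝ᵥ avgHess f a b *ᵥ v - v ⬝ᵥ hess f a *ᵥ v =
      ∫ τ in (0 : ℝ)..1, v ⬝ᵥ (hess f (a + τ • (b - a)) - hess f a) *ᵥ v := by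
    simp only [sub_mulVec, dotProduct_sub]
    rw [intervalIntegral.integral_sub (intervalIntegrable_quadratic_hess hf a b v) (by simp),
      quadratic_avgHess hf]
    simp
  have hbound : ∫ τ in (0 : ℝ)..1, L' * ‖b - a‖ * (v ⬝ᵥ v) * τ =
      L' * ‖b - a‖ / 2 * (v ⬝ᵥ v) := by
    rw [intervalIntegral.integral_const_mul, integral_id]
    ring
  rw [hdiff, ← hbound, ← Real.norm_eq_abs]
  refine intervalIntegral.norm_integral_le_of_norm_le zero_le_one
    (Filter.Eventually.of_forall fun τ hτ => ?_) (Continuous.intervalIntegrable (by fun_prop) _ _)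
  have hlip := h a (a + τ • (b - a))
  rw [add_sub_cancel_left, norm_smul, Real.norm_eq_abs, abs_of_pos hτ.1] at hlip
  calc ‖v ⬝ᵥ (hess f (a + τ • (b - a)) - hess f a) *ᵥ v‖
      ≤ specNorm (hess f (a + τ • (b - a)) - hess f a) * ‖WithLp.toLp 2 v‖ ^ 2 :=
        abs_quadratic_le _ (WithLp.toLp 2 v)
    _ ≤ L' * (τ * ‖b - a‖) * ‖WithLp.toLp 2 v‖ ^ 2 := by gcongr
    _ = L' * ‖b - a‖ * (v ⬝ᵥ v) * τ := by rw [← dotProduct_self_eq_norm_sq]; ring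

theorem relClose_hess_avgHess {μ L L' c : ℝ} (hf : ContDiff ℝ 2 f)
    (hconv : StrongConvexSmooth μ L f) (hlip : LipschitzHessian L' f) (hc0 : 0 ≤ c)
    (a b : EuclideanSpace ℝ (Fin d)) (hc : L' * ‖b - a‖ / 2 ≤ c * μ) :
    RelClose (1 + c) (hess f a) (avgHess f a b) :=
  relClose_of_abs_quadratic_sub_le hc0 (isHermitian_hess hf a) (isHermitian_avgHess hf a b)
    (smul_one_le_hess hf hconv a) (smul_one_le_avgHess hf hconv a b) fun v => by
      rw [abs_sub_comm, ← mul_assoc]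
      refine (abs_quadratic_avgHess_sub_le hf hlip a b v).trans ?_
      gcongr
      simpa using dotProduct_star_self_nonneg v

theorem sum_gradient_eq_zero {F ι : Type*} [NormedAddCommGroup F] [InnerProductSpace ℝ F]
    [CompleteSpace F] [Fintype ι] {f : ι → F → ℝ} {x : F} (hf : ∀ i, DifferentiableAt ℝ (f i) x)
    {c : ℝ} (hc : 0 < c) (hx : IsMinOn (fun y => c * ∑ i, f i y) Set.univ x) :
    ∑ i, ∇ (f i) x = 0 := by
  have hmin : IsLocalMin (fun y => ∑ i, f i y) x :=
    Filter.Eventually.of_forall fun y => le_of_mul_le_mul_left (hx (Set.mem_univ y)) hc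
  have hzero := hmin.hasFDerivAt_eq_zero (HasFDerivAt.fun_sum fun i _ => (hf i).hasFDerivAt)
  simp only [gradient, ← map_sum, hzero, map_zero]

end Hessian

section Counting

variable {n : ℕ}

theorem ceil_succ_div [NeZero n] (t : ℕ) : ⌈((t + 1 : ℕ) : ℝ) / n⌉₊ = t / n + 1 := by
  have hn : 0 < n := NeZero.pos n
  have hn' : (0 : ℝ) < n := by exact_mod_cast hn
  rw [Nat.ceil_eq_iff (Nat.succ_ne_zero _), Nat.succ_sub_one, lt_div_iff₀ hn', div_le_iff₀ hn']
  constructor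
  · exact_mod_cast Nat.lt_succ_of_le (Nat.div_mul_le_self t n)
  · exact_mod_cast Nat.succ_le_of_lt ((Nat.div_lt_iff_lt_mul hn).1 (Nat.lt_succ_self (t / n)))

theorem ceil_succ_div_sub_one [NeZero n] (t : ℕ) : ⌈((t + 1 : ℕ) : ℝ) / n - 1⌉₊ = t / n := by
  rw [Nat.ceil_sub_one, ceil_succ_div, Nat.add_sub_cancel]

theorem idx_succ_val [NeZero n] (t : ℕ) : (idx n (t + 1)).val = t % n := rfl

theorem succ_mod_of_not_dvd {t : ℕ} (h : ¬ n ∣ t + 1) : (t + 1) % n = t % n + 1 := by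
  have hsucc := Nat.div_add_mod (t + 1) n
  have ht := Nat.div_add_mod t n
  rw [Nat.succ_div_of_not_dvd h] at hsucc
  lia

theorem mod_succ_of_dvd {t : ℕ} (h : n ∣ t + 1) : t % n + 1 = n := by
  have hsucc := Nat.div_mul_cancel h
  have ht := Nat.div_add_mod t n
  rw [Nat.succ_div_of_dvd h, Nat.add_mul, Nat.one_mul, Nat.mul_comm] at hsucc
  lia

theorem omega_succ [NeZero n] (α : ℕ → ℝ) (t : ℕ) :
    omega n α (t + 1) = if n ∣ t + 1 then (1 + α (t / n + 1)) ^ 2 else 1 := by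
  rw [omega, ceil_succ_div]

theorem omega_pos (n : ℕ) {α : ℕ → ℝ} (hα : ∀ k, 0 ≤ α k) (t : ℕ) : 0 < omega n α t := by
  unfold omega
  split_ifs
  · have := hα ⌈(t : ℝ) / n⌉₊
    positivity
  · exact one_pos

end Counting

section ErrorBound

variable {d : ℕ} {c σ₀ : ℝ} {α : ℕ → ℝ}

/-- The worst-case approximation error `σ` after `k` passes through the components: in pass `k`
the scaling and the classical BFGS update cost the factor `(1 + α k) ^ 4` on `σ + d`, and the
greedy update gains the factor `c`. -/
def errorBound (d : ℕ) (c σ₀ : ℝ) (α : ℕ → ℝ) : ℕ → ℝ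
  | 0 => σ₀
  | k + 1 => c * ((1 + α k) ^ 4 * (errorBound d c σ₀ α k + d) - d)

theorem le_pow_mul_add_sub {a σ : ℝ} (ha : 0 ≤ a) (hσ : 0 ≤ σ) (m d : ℕ) :
    σ ≤ (1 + a) ^ m * (σ + d) - d := by
  have hpow : 1 ≤ (1 + a) ^ m := one_le_pow₀ (le_add_of_nonneg_right ha)
  have hd : (0 : ℝ) ≤ σ + d := by positivity
  linarith [mul_le_mul_of_nonneg_right hpow hd]

theorem errorBound_nonneg (d : ℕ) (hc : 0 ≤ c) (hσ₀ : 0 ≤ σ₀) (hα : ∀ k, 0 ≤ α k) (k : ℕ) :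
    0 ≤ errorBound d c σ₀ α k := by
  induction k with
  | zero => exact hσ₀
  | succ k ih => exact mul_nonneg hc (ih.trans (le_pow_mul_add_sub (hα k) ih 4 d))

theorem pow_four_mul_add_sub_le {a σ : ℝ} (ha : 0 ≤ a) (hσ : 0 ≤ σ) (d : ℕ) :
    (1 + a) ^ 4 * (σ + d) - d ≤ Real.exp (4 * a) * (σ + 4 * d * a) := by
  have hpow : (1 + a) ^ 4 ≤ Real.exp (4 * a) := by
    calc (1 + a) ^ 4 ≤ Real.exp a ^ 4 := by gcongr; linarith [Real.add_one_le_exp a]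
      _ = Real.exp (4 * a) := by rw [← Real.exp_nat_mul]; norm_num
  have hexp : Real.exp (4 * a) - 1 ≤ Real.exp (4 * a) * (4 * a) := by
    have h := mul_le_mul_of_nonneg_left (Real.add_one_le_exp (-(4 * a))) (Real.exp_pos (4 * a)).le
    rw [← Real.exp_add, add_neg_cancel, Real.exp_zero] at h
    linarith
  have hd : (0 : ℝ) ≤ d := Nat.cast_nonneg d
  linarith [mul_le_mul_of_nonneg_right hpow (add_nonneg hσ hd), mul_le_mul_of_nonneg_right hexp hd]

theorem errorBound_le (d : ℕ) (hc : 0 < c) (hσ₀ : 0 ≤ σ₀) (hα : ∀ k, 0 ≤ α k) (k : ℕ) :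
    errorBound d c σ₀ α k ≤ c ^ k * (Real.exp (4 * ∑ j ∈ Finset.range k, α j) *
      (σ₀ + ∑ j ∈ Finset.range k, 4 * d * (α j / c ^ j))) := by
  induction k with
  | zero => simp [errorBound]
  | succ k ih =>
    set E := Real.exp (4 * ∑ j ∈ Finset.range k, α j) with hE
    set T := ∑ j ∈ Finset.range k, 4 * d * (α j / c ^ j)
    have hE1 : 1 ≤ E :=
      Real.one_le_exp (mul_nonneg (by norm_num) (Finset.sum_nonneg fun j _ => hα j))
    have hαk : 0 ≤ 4 * d * α k := by have := hα k; positivity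
    rw [errorBound, Finset.sum_range_succ, Finset.sum_range_succ, mul_add 4, Real.exp_add, ← hE]
    calc c * ((1 + α k) ^ 4 * (errorBound d c σ₀ α k + d) - d)
        ≤ c * (Real.exp (4 * α k) * (errorBound d c σ₀ α k + 4 * d * α k)) := by
          gcongr
          exact pow_four_mul_add_sub_le (hα k) (errorBound_nonneg d hc.le hσ₀ hα k) d
      _ ≤ c * (Real.exp (4 * α k) * (c ^ k * (E * (σ₀ + T)) + E * (4 * d * α k))) := by
          have := add_le_add ih (le_mul_of_one_le_left hαk hE1)
          gcongr
      _ = c ^ (k + 1) * (E * Real.exp (4 * α k) * (σ₀ + (T + 4 * d * (α k / c ^ k)))) := by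
          field_simp
          ring

end ErrorBound

section Parameters

variable {d : ℕ} {μ L L' ε ρ σ₀ : ℝ}

theorem selfConc_nonneg (hμ : 0 ≤ μ) (hL' : 0 ≤ L') : 0 ≤ selfConc μ L' :=
  div_nonneg hL' (Real.rpow_nonneg hμ _)

theorem le_selfConc_mul (hμ : 0 < μ) (hμL : μ ≤ L) (hL' : 0 ≤ L') :
    L' ≤ selfConc μ L' * √L * μ := by
  have hpow : μ ^ (3 / 2 : ℝ) = μ * √μ := by
    rw [Real.sqrt_eq_rpow, ← Real.rpow_one_add' hμ.le (by norm_num)]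
    norm_num
  have : 0 < √μ := Real.sqrt_pos.2 hμ
  calc L' = L' * √μ / √μ := by field_simp
    _ ≤ L' * √L / √μ := by gcongr
    _ = selfConc μ L' * √L * μ := by rw [selfConc, hpow]; field_simp

theorem alpha_nonneg (hM : 0 ≤ selfConc μ L') (hε : 0 ≤ ε) (hρ : 0 ≤ ρ) (k : ℕ) :
    0 ≤ alpha μ L L' ε ρ k := by
  rw [alpha]
  positivity

theorem alpha_le_alpha_zero (hM : 0 ≤ selfConc μ L') (hε : 0 ≤ ε) (hρ0 : 0 ≤ ρ) (hρ1 : ρ ≤ 1)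
    (k : ℕ) : alpha μ L L' ε ρ k ≤ alpha μ L L' ε ρ 0 := by
  rw [alpha, alpha, pow_zero]
  gcongr
  exact pow_le_one₀ hρ0 hρ1

theorem sum_geometric_le {r : ℝ} (hr0 : 0 ≤ r) (hr1 : r < 1) (m : ℕ) :
    ∑ j ∈ Finset.range m, r ^ j ≤ 1 / (1 - r) := by
  rw [Finset.range_eq_Ico, ← pow_zero r]
  exact geom_sum_Ico_le_of_lt_one hr0 hr1

theorem errorBound_alpha_le (hM : 0 ≤ selfConc μ L') (hε : 0 ≤ ε) (hρ0 : 0 < ρ)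
    (hρ1 : ρ < 1) (hρc : ρ < 1 - μ / (d * L)) (hσ₀ : 0 ≤ σ₀) (k : ℕ) :
    errorBound d (1 - μ / (d * L)) σ₀ (alpha μ L L' ε ρ) k ≤
      (1 - μ / (d * L)) ^ k * delta d μ L L' ε ρ σ₀ := by
  have hα := alpha_nonneg (L := L) hM hε hρ0.le
  have hc : 0 < 1 - μ / (d * L) := hρ0.trans hρc
  refine (errorBound_le d hc hσ₀ hα k).trans ?_
  rw [delta]
  set c := 1 - μ / (d * L)
  have hexp : 4 * ∑ j ∈ Finset.range k, alpha μ L L' ε ρ j ≤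
      4 * selfConc μ L' * √L * ε / (1 - ρ) := by
    simp only [alpha, ← Finset.mul_sum]
    calc 4 * (selfConc μ L' * √L * ε * ∑ j ∈ Finset.range k, ρ ^ j)
        ≤ 4 * (selfConc μ L' * √L * ε * (1 / (1 - ρ))) := by
          gcongr
          exact sum_geometric_le hρ0.le hρ1 k
      _ = 4 * selfConc μ L' * √L * ε / (1 - ρ) := by ring
  have hsum : ∑ j ∈ Finset.range k, 4 * d * (alpha μ L L' ε ρ j / c ^ j) ≤
      ε * (4 * selfConc μ L' * d * √L / (1 - ρ / c)) := by
    calc ∑ j ∈ Finset.range k, 4 * d * (alpha μ L L' ε ρ j / c ^ j)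
        = 4 * d * (selfConc μ L' * √L * ε) * ∑ j ∈ Finset.range k, (ρ / c) ^ j := by
          rw [Finset.mul_sum]
          exact Finset.sum_congr rfl fun j _ => by rw [alpha, div_pow]; ring
      _ ≤ 4 * d * (selfConc μ L' * √L * ε) * (1 / (1 - ρ / c)) := by
          gcongr
          exact sum_geometric_le (div_nonneg hρ0.le hc.le) ((div_lt_one hc).2 hρc) k
      _ = ε * (4 * selfConc μ L' * d * √L / (1 - ρ / c)) := by ring
  have hnonneg : 0 ≤ ∑ j ∈ Finset.range k, 4 * d * (alpha μ L L' ε ρ j / c ^ j) :=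
    Finset.sum_nonneg fun j _ => by have := hα j; positivity
  gcongr

theorem delta_nonneg (hM : 0 ≤ selfConc μ L') (hε : 0 ≤ ε) (hρ0 : 0 < ρ)
    (hρc : ρ < 1 - μ / (d * L)) (hσ₀ : 0 ≤ σ₀) : 0 ≤ delta d μ L L' ε ρ σ₀ := by
  have : 0 ≤ 1 - ρ / (1 - μ / (d * L)) :=
    sub_nonneg.2 ((div_le_one (hρ0.trans hρc)).2 hρc.le)
  rw [delta]
  positivity

theorem exists_radius (d : ℕ) (L L' : ℝ) (hμρ : 0 < ρ * μ) :
    ∃ ε > 0, L * ((1 + alpha μ L L' ε ρ 0) ^ 2 * (delta d μ L L' ε ρ ε + d) - d) + L' * ε ≤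
      ρ * μ := by
  have hcont : Continuous fun ε : ℝ =>
      L * ((1 + alpha μ L L' ε ρ 0) ^ 2 * (delta d μ L L' ε ρ ε + d) - d) + L' * ε := by
    unfold alpha delta
    fun_prop
  have hzero : L * ((1 + alpha μ L L' 0 ρ 0) ^ 2 * (delta d μ L L' 0 ρ 0 + d) - d) + L' * 0 <
      ρ * μ := by
    simpa [alpha, delta] using hμρ
  have hnear := (hcont.tendsto 0).eventually (gt_mem_nhds hzero)
  obtain ⟨ε, hle, hpos⟩ :=
    ((hnear.filter_mono nhdsWithin_le_nhds).and (self_mem_nhdsWithin (s := Set.Ioi 0))).exists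
  exact ⟨ε, hpos, hle.le⟩

end Parameters

section Component

variable {d : ℕ} {μ L L' : ℝ} {g : EuclideanSpace ℝ (Fin d) → ℝ}
  {z w : EuclideanSpace ℝ (Fin d)} {B : Matrix (Fin d) (Fin d) ℝ}

/-- The assumptions on one component function, together with the signs of its constants. -/
structure Regular (μ L L' : ℝ) (g : EuclideanSpace ℝ (Fin d) → ℝ) : Prop where
  strong_pos : 0 < μ
  smooth_pos : 0 < L
  lipschitz_nonneg : 0 ≤ L'
  contDiff : ContDiff ℝ 2 g
  strongConvexSmooth : StrongConvexSmooth μ L g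
  lipschitzHessian : LipschitzHessian L' g

theorem Regular.smul_one_le_hess (hg : Regular μ L L' g) (z : EuclideanSpace ℝ (Fin d)) :
    μ • 1 ≤ hess g z :=
  SLIQN.smul_one_le_hess hg.contDiff hg.strongConvexSmooth z

theorem Regular.hess_le_smul_one (hg : Regular μ L L' g) (z : EuclideanSpace ℝ (Fin d)) :
    hess g z ≤ L • 1 :=
  SLIQN.hess_le_smul_one hg.contDiff hg.strongConvexSmooth z

theorem Regular.posDef_hess (hg : Regular μ L L' g) (z : EuclideanSpace ℝ (Fin d)) :
    (hess g z).PosDef :=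
  posDef_of_le (PosDef.one.smul hg.strong_pos) (hg.smul_one_le_hess z)

theorem Regular.norm_residual_le (hg : Regular μ L L' g) (hB : hess g z ≤ B)
    (w : EuclideanSpace ℝ (Fin d)) :
    ‖app B (z - w) - (∇ g z - ∇ g w)‖ ≤
      (L * sigma B (hess g z) + L' * ‖z - w‖) * ‖z - w‖ := by
  have hsplit : app B (z - w) - (∇ g z - ∇ g w) =
      app (B - hess g z) (z - w) + (app (hess g z) (z - w) - (∇ g z - ∇ g w)) := by
    rw [sub_app]
    abel
  have htrace : specNorm (B - hess g z) ≤ L * sigma B (hess g z) :=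
    (specNorm_le_trace (le_iff.mp hB)).trans
      (trace_sub_le_mul_sigma hg.smooth_pos (hg.posDef_hess z) (hg.hess_le_smul_one z) hB)
  rw [hsplit]
  calc _ ≤ _ := norm_add_le _ _
    _ ≤ L * sigma B (hess g z) * ‖z - w‖ + L' * ‖z - w‖ ^ 2 := by
        gcongr
        · exact (norm_app_le _ _).trans (by gcongr)
        · exact norm_app_hess_sub_gradient_sub_le hg.lipschitz_nonneg hg.contDiff
            hg.lipschitzHessian w z
    _ = (L * sigma B (hess g z) + L' * ‖z - w‖) * ‖z - w‖ := by ring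

/-- The state of one component: `B` is an upper approximation of the Hessian at `z` with error at
most `s`, and `z` is within `r` of `w`, which will be the minimizer. -/
structure Tracks (g : EuclideanSpace ℝ (Fin d) → ℝ) (w : EuclideanSpace ℝ (Fin d)) (s r : ℝ)
    (z : EuclideanSpace ℝ (Fin d)) (B : Matrix (Fin d) (Fin d) ℝ) : Prop where
  hess_le : hess g z ≤ B
  sigma_le : sigma B (hess g z) ≤ s
  norm_le : ‖z - w‖ ≤ r

theorem Tracks.smul {c s r : ℝ} (h : Tracks g w s r z B) (hH : (hess g z).PosDef) (hc : 1 ≤ c) :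
    Tracks g w (c * (s + d) - d) r z (c • B) where
  hess_le := h.hess_le.trans
    (le_smul_of_one_le_left (nonneg_iff_posSemidef.2 (posDef_of_le hH h.hess_le).posSemidef) hc)
  sigma_le := by
    rw [sigma_smul hH]
    gcongr
    exact h.sigma_le
  norm_le := h.norm_le

theorem Tracks.norm_residual_le {s r r' ρ : ℝ} (h : Tracks g w s r z B) (hg : Regular μ L L' g)
    (hs : L * s + L' * r ≤ ρ * μ) (hr : r ≤ r') :
    ‖app B (z - w) - (∇ g z - ∇ g w)‖ ≤ μ * (ρ * r') := by
  have hL := hg.smooth_pos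
  have hL' := hg.lipschitz_nonneg
  have hrate : L * sigma B (hess g z) + L' * ‖z - w‖ ≤ ρ * μ :=
    le_trans (by gcongr; exacts [h.sigma_le, h.norm_le]) hs
  have hσ : 0 ≤ sigma B (hess g z) := sigma_nonneg (hg.posDef_hess z).posSemidef h.hess_le
  calc ‖app B (z - w) - (∇ g z - ∇ g w)‖
      ≤ (L * sigma B (hess g z) + L' * ‖z - w‖) * ‖z - w‖ := hg.norm_residual_le h.hess_le w
    _ ≤ (ρ * μ) * r' :=
        mul_le_mul hrate (h.norm_le.trans hr) (norm_nonneg _) (le_trans (by positivity) hrate)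
    _ = μ * (ρ * r') := by ring

theorem Tracks.update {a s r r' : ℝ} {z' u : EuclideanSpace ℝ (Fin d)} (h : Tracks g w s r z B)
    (hg : Regular μ L L' g) (hc : 0 ≤ 1 - μ / (d * L)) (ha : 0 ≤ a) (hr : r' ≤ r)
    (har : L' * r ≤ a * μ) (hz' : ‖z' - w‖ ≤ r')
    (hu : IsGreedyVec (bfgs ((1 + a) ^ 2 • B) ((1 + a) • avgHess g z z') (z' - z))
      (hess g z') u) :
    Tracks g w ((1 - μ / (d * L)) * ((1 + a) ^ 4 * (s + d) - d)) r' z'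
      (bfgs (bfgs ((1 + a) ^ 2 • B) ((1 + a) • avgHess g z z') (z' - z)) (hess g z') u) := by
  have hdist : ‖z' - z‖ ≤ 2 * r := by
    have := norm_sub_le (z' - w) (z - w)
    rw [sub_sub_sub_cancel_right] at this
    linarith [h.norm_le]
  have hshort : L' * ‖z' - z‖ / 2 ≤ a * μ := by
    linarith [mul_le_mul_of_nonneg_left hdist hg.lipschitz_nonneg]
  have ha' : 0 < 1 + a := by positivity
  have hKpos : (avgHess g z z').PosDef :=
    posDef_of_le (PosDef.one.smul hg.strong_pos)
      (smul_one_le_avgHess hg.contDiff hg.strongConvexSmooth z z')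
  have hH : RelClose (1 + a) (hess g z) (avgHess g z z') :=
    relClose_hess_avgHess hg.contDiff hg.strongConvexSmooth hg.lipschitzHessian ha z z' hshort
  have hH' : RelClose (1 + a) (hess g z') (avgHess g z z') := by
    rw [avgHess_comm]
    exact relClose_hess_avgHess hg.contDiff hg.strongConvexSmooth hg.lipschitzHessian ha z' z
      (by rwa [norm_sub_rev])
  have hQ := hH.le_bfgs ha' hKpos hH' h.hess_le (z' - z)
  refine ⟨le_bfgs (hg.posDef_hess z').posSemidef hQ u, ?_, hz'⟩
  refine (hu.sigma_bfgs_le hg.strong_pos (hg.smul_one_le_hess z') (hg.hess_le_smul_one z')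
    hQ).trans (mul_le_mul_of_nonneg_left ?_ hc)
  rw [le_sub_iff_add_le]
  refine (hH.sigma_bfgs_add_dim_le ha' hKpos hH' h.hess_le (z' - z)).trans ?_
  gcongr
  exact h.sigma_le

theorem norm_app_inv_sum_sub_le {ι : Type*} [Fintype ι] [Nonempty ι] (hμ : 0 < μ)
    {D : ι → Matrix (Fin d) (Fin d) ℝ} (hD : ∀ i, μ • 1 ≤ D i)
    {z y y' : ι → EuclideanSpace ℝ (Fin d)} (hy' : ∑ i, y' i = 0) {b : ℝ}
    (h : ∀ i, ‖app (D i) (z i - w) - (y i - y' i)‖ ≤ μ * b) :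
    ‖app (∑ i, D i)⁻¹ (∑ i, (app (D i) (z i) - y i)) - w‖ ≤ b := by
  have hpos : 0 < Fintype.card ι * μ := by positivity
  have hsum : (Fintype.card ι * μ) • (1 : Matrix (Fin d) (Fin d) ℝ) ≤ ∑ i, D i := by
    simpa [mul_smul, Nat.cast_smul_eq_nsmul] using
      Finset.sum_le_sum fun i (_ : i ∈ Finset.univ) => hD i
  have hDpos := posDef_of_le (PosDef.one.smul hpos) hsum
  have hstep : app (∑ i, D i)⁻¹ (∑ i, (app (D i) (z i) - y i)) - w =
      app (∑ i, D i)⁻¹ (∑ i, (app (D i) (z i - w) - (y i - y' i))) := by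
    conv_lhs => rw [← app_inv_self hDpos w]
    rw [← app_sub, sum_app]
    congr 1
    simp only [app_sub, Finset.sum_sub_distrib, hy', sub_zero]
    abel
  refine le_of_mul_le_mul_left ?_ hpos
  rw [hstep]
  calc Fintype.card ι * μ * _ ≤ _ := mul_norm_app_inv_le hpos hsum _
    _ ≤ ∑ _i : ι, μ * b := norm_sum_le_of_le _ fun i _ => h i
    _ = Fintype.card ι * μ * b := by simp [mul_assoc]

end Component

section Schedule

variable {d : ℕ} {μ L L' ρ : ℝ} {α S R : ℕ → ℝ}

/-- Bounds `S k` for the approximation error and `R k` for the distance to the minimizer after `k`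
passes, compatible with the scaling sequence `α`: each pass reproduces them, and they are small
enough for a step of the method to contract with factor `ρ`. -/
structure IsSchedule (d : ℕ) (μ L L' ρ : ℝ) (α S R : ℕ → ℝ) : Prop where
  gain_nonneg : 0 ≤ 1 - μ / (d * L)
  scale_nonneg : ∀ k, 0 ≤ α k
  error_nonneg : ∀ k, 0 ≤ S k
  error_succ : ∀ k, S (k + 1) = (1 - μ / (d * L)) * ((1 + α k) ^ 4 * (S k + d) - d)
  radius_succ : ∀ k, R (k + 1) = ρ * R k
  radius_antitone : Antitone R
  lipschitz_mul_radius_le : ∀ k, L' * R k ≤ α k * μ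
  contraction : ∀ k, L * ((1 + α k) ^ 2 * (S k + d) - d) + L' * R k ≤ ρ * μ

theorem isSchedule_alpha {ε r : ℝ} (hμ : 0 < μ) (hμL : μ ≤ L) (hL' : 0 ≤ L') (hρ0 : 0 < ρ)
    (hρ1 : ρ < 1) (hρc : ρ < 1 - μ / (d * L)) (hε : 0 ≤ ε)
    (hsmall : L * ((1 + alpha μ L L' ε ρ 0) ^ 2 * (delta d μ L L' ε ρ ε + d) - d) + L' * ε ≤
      ρ * μ) (hr0 : 0 ≤ r) (hr : r ≤ ε) :
    IsSchedule d μ L L' ρ (alpha μ L L' ε ρ)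
      (errorBound d (1 - μ / (d * L)) ε (alpha μ L L' ε ρ)) (fun k => ρ ^ k * r) := by
  have hL : 0 < L := hμ.trans_le hμL
  have hM := selfConc_nonneg hμ.le hL'
  have hα := alpha_nonneg (L := L) hM hε hρ0.le
  have hc := hρ0.le.trans hρc.le
  have hc1 : 1 - μ / (d * L) ≤ 1 := sub_le_self _ (by positivity)
  have hS := errorBound_nonneg d hc hε hα
  have hδ := delta_nonneg hM hε hρ0 hρc hε
  refine ⟨hc, hα, hS, fun _ => rfl, fun k => by ring,
    fun j k hjk => mul_le_mul_of_nonneg_right (pow_le_pow_of_le_one hρ0.le hρ1.le hjk) hr0,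
    fun k => ?_, fun k => le_trans ?_ hsmall⟩
  · calc L' * (ρ ^ k * r) ≤ (selfConc μ L' * √L * μ) * (ρ ^ k * ε) := by
          gcongr
          exact le_selfConc_mul hμ hμL hL'
      _ = alpha μ L L' ε ρ k * μ := by rw [alpha]; ring
  · have hSδ : errorBound d (1 - μ / (d * L)) ε (alpha μ L L' ε ρ) k ≤ delta d μ L L' ε ρ ε :=
      (errorBound_alpha_le hM hε hρ0 hρ1 hρc hε k).trans
        (mul_le_of_le_one_left hδ (pow_le_one₀ hc hc1))
    have hRε : ρ ^ k * r ≤ ε := (mul_le_of_le_one_left hr0 (pow_le_one₀ hρ0.le hρ1.le)).trans hr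
    have := hα k
    have := hS k
    gcongr
    exact alpha_le_alpha_zero hM hε hρ0.le hρ1.le k

end Schedule

section Pass

variable {d n : ℕ} {f : Fin n → EuclideanSpace ℝ (Fin d) → ℝ} {μ L L' ρ : ℝ} {α S R : ℕ → ℝ}
  {w : EuclideanSpace ℝ (Fin d)}

/-- The state of the method after `t` iterations: the first `t % n` components have been updated
in the current pass, the other ones still carry the scaling factor of that pass. -/
structure PassInvariant (f : Fin n → EuclideanSpace ℝ (Fin d) → ℝ) (w : EuclideanSpace ℝ (Fin d))
    (α S R : ℕ → ℝ) (t : ℕ) (z : Fin n → EuclideanSpace ℝ (Fin d))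
    (D : Fin n → Matrix (Fin d) (Fin d) ℝ) : Prop where
  updated : ∀ i : Fin n, i.val < t % n →
    Tracks (f i) w (S (t / n + 1)) (R (t / n + 1)) (z i) (D i)
  pending : ∀ i : Fin n, t % n ≤ i.val → ∃ B, D i = (1 + α (t / n)) ^ 2 • B ∧
    Tracks (f i) w (S (t / n)) (R (t / n)) (z i) B

variable {t : ℕ} {z : Fin n → EuclideanSpace ℝ (Fin d)} {D : Fin n → Matrix (Fin d) (Fin d) ℝ}

theorem PassInvariant.hess_le_and_norm_residual_le (h : PassInvariant f w α S R t z D)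
    (hf : ∀ i, Regular μ L L' (f i)) (hsched : IsSchedule d μ L L' ρ α S R) (i : Fin n) :
    hess (f i) (z i) ≤ D i ∧
      ‖app (D i) (z i - w) - (∇ (f i) (z i) - ∇ (f i) w)‖ ≤ μ * R (t / n + 1) := by
  obtain ⟨s, r, hs, hr, hT⟩ : ∃ s r, L * s + L' * r ≤ ρ * μ ∧ r ≤ R (t / n) ∧
      Tracks (f i) w s r (z i) (D i) := by
    rcases lt_or_ge i.val (t % n) with hi | hi
    · refine ⟨_, _, le_trans ?_ (hsched.contraction (t / n + 1)),
        hsched.radius_antitone (Nat.le_succ _), h.updated i hi⟩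
      have hL := (hf i).smooth_pos
      gcongr
      exact le_pow_mul_add_sub (hsched.scale_nonneg _) (hsched.error_nonneg _) 2 d
    · obtain ⟨B, hB, hT⟩ := h.pending i hi
      refine ⟨_, _, hsched.contraction (t / n), le_rfl, hB ▸ hT.smul ((hf i).posDef_hess _) ?_⟩
      exact one_le_pow₀ (le_add_of_nonneg_right (hsched.scale_nonneg _))
  exact ⟨hT.hess_le, hsched.radius_succ _ ▸ hT.norm_residual_le (hf i) hs hr⟩

theorem PassInvariant.norm_step_sub_le [NeZero n] (h : PassInvariant f w α S R t z D)
    (hf : ∀ i, Regular μ L L' (f i)) (hsched : IsSchedule d μ L L' ρ α S R)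
    (hw : ∑ i, ∇ (f i) w = 0) :
    ‖app (∑ i, D i)⁻¹ (∑ i, (app (D i) (z i) - ∇ (f i) (z i))) - w‖ ≤ R (t / n + 1) :=
  norm_app_inv_sum_sub_le (hf 0).strong_pos
    (fun i => ((hf i).smul_one_le_hess _).trans (h.hess_le_and_norm_residual_le hf hsched i).1) hw
    fun i => (h.hess_le_and_norm_residual_le hf hsched i).2

theorem passInvariant_succ_of_eq_omega_smul [NeZero n] {B : Fin n → Matrix (Fin d) (Fin d) ℝ}
    (hD : ∀ i, D i = omega n α (t + 1) • B i)
    (hupdated : ∀ i : Fin n, i.val ≤ t % n →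
      Tracks (f i) w (S (t / n + 1)) (R (t / n + 1)) (z i) (B i))
    (hpending : ∀ i : Fin n, t % n < i.val → ∃ C, B i = (1 + α (t / n)) ^ 2 • C ∧
      Tracks (f i) w (S (t / n)) (R (t / n)) (z i) C) :
    PassInvariant f w α S R (t + 1) z D := by
  by_cases hdvd : n ∣ t + 1
  · have hlast := mod_succ_of_dvd hdvd
    constructor <;> rw [Nat.succ_div_of_dvd hdvd, Nat.mod_eq_zero_of_dvd hdvd]
    · exact fun i hi => absurd hi (Nat.not_lt_zero _)
    · refine fun i _ => ⟨B i, ?_, hupdated i (by lia)⟩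
      rw [hD, omega_succ, if_pos hdvd]
  · obtain rfl : D = B := funext fun i => by rw [hD, omega_succ, if_neg hdvd, one_smul]
    constructor <;> rw [Nat.succ_div_of_not_dvd hdvd, succ_mod_of_not_dvd hdvd]
    · exact fun i hi => hupdated i (by lia)
    · exact fun i hi => hpending i (by lia)

end Pass

section Run

variable {d n : ℕ} [NeZero n] {f : Fin n → EuclideanSpace ℝ (Fin d) → ℝ} {μ L L' ρ : ℝ}
  {α S R : ℕ → ℝ} {w : EuclideanSpace ℝ (Fin d)} {I₀ : Fin n → Matrix (Fin d) (Fin d) ℝ}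
  {x : ℕ → EuclideanSpace ℝ (Fin d)} {z : ℕ → Fin n → EuclideanSpace ℝ (Fin d)}
  {D : ℕ → Fin n → Matrix (Fin d) (Fin d) ℝ}

theorem IsRun.passInvariant_zero (hrun : IsRun f α I₀ x z D)
    (hI₀ : ∀ i, Tracks (f i) w (S 0) (R 0) (x 0) (I₀ i)) :
    PassInvariant f w α S R 0 (z 0) (D 0) where
  updated i hi := by simp at hi
  pending i _ := by
    rw [Nat.zero_div, hrun.z_zero]
    exact ⟨I₀ i, hrun.D_zero i, hI₀ i⟩

theorem IsRun.tracks_succ (hrun : IsRun f α I₀ x z D) (hf : ∀ i, Regular μ L L' (f i))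
    (hsched : IsSchedule d μ L L' ρ α S R) (hw : ∑ i, ∇ (f i) w = 0) {t : ℕ}
    (h : PassInvariant f w α S R t (z t) (D t)) :
    Tracks (f (idx n (t + 1))) w (S (t / n + 1)) (R (t / n + 1)) (z (t + 1) (idx n (t + 1)))
      ((omega n α (t + 1))⁻¹ • D (t + 1) (idx n (t + 1))) := by
  have hnorm : ‖z (t + 1) (idx n (t + 1)) - w‖ ≤ R (t / n + 1) := by
    rw [hrun.z_update _ t.succ_pos, hrun.x_update _ t.succ_pos]
    exact h.norm_step_sub_le hf hsched hw
  obtain ⟨B, hB, hT⟩ := h.pending (idx n (t + 1)) (idx_succ_val t).ge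
  obtain ⟨u, hu, hDu⟩ := hrun.D_update (t + 1) t.succ_pos
  rw [hDu, inv_smul_smul₀ (omega_pos n hsched.scale_nonneg _).ne', hsched.error_succ]
  rw [classicUpdate, ceil_succ_div_sub_one, Nat.add_sub_cancel, hB] at hu ⊢
  exact hT.update (hf _) hsched.gain_nonneg (hsched.scale_nonneg _)
    (hsched.radius_antitone (Nat.le_succ _)) (hsched.lipschitz_mul_radius_le _) hnorm hu

theorem IsRun.passInvariant_succ (hrun : IsRun f α I₀ x z D) (hf : ∀ i, Regular μ L L' (f i))
    (hsched : IsSchedule d μ L L' ρ α S R) (hw : ∑ i, ∇ (f i) w = 0) {t : ℕ}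
    (h : PassInvariant f w α S R t (z t) (D t)) :
    PassInvariant f w α S R (t + 1) (z (t + 1)) (D (t + 1)) := by
  have hω := (omega_pos n hsched.scale_nonneg (t + 1)).ne'
  have hkeep {i : Fin n} (hi : i.val ≠ t % n) :
      z (t + 1) i = z t i ∧ (omega n α (t + 1))⁻¹ • D (t + 1) i = D t i := by
    have hne : i ≠ idx n (t + 1) := fun h => hi (congrArg Fin.val h)
    rw [hrun.z_keep _ t.succ_pos i hne, hrun.D_keep _ t.succ_pos i hne, inv_smul_smul₀ hω]
    exact ⟨rfl, rfl⟩
  refine passInvariant_succ_of_eq_omega_smul (B := fun i => (omega n α (t + 1))⁻¹ • D (t + 1) i)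
    (fun i => (smul_inv_smul₀ hω _).symm) (fun i hi => ?_) (fun i hi => ?_)
  · rcases hi.eq_or_lt with hi | hi
    · obtain rfl : i = idx n (t + 1) := Fin.ext hi
      exact hrun.tracks_succ hf hsched hw h
    · rw [(hkeep hi.ne).1, (hkeep hi.ne).2]
      exact h.updated i hi
  · rw [(hkeep hi.ne').1, (hkeep hi.ne').2]
    exact h.pending i hi.le

theorem IsRun.tracks (hrun : IsRun f α I₀ x z D) (hf : ∀ i, Regular μ L L' (f i))
    (hsched : IsSchedule d μ L L' ρ α S R) (hw : ∑ i, ∇ (f i) w = 0)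
    (hI₀ : ∀ i, Tracks (f i) w (S 0) (R 0) (x 0) (I₀ i)) (t : ℕ) :
    Tracks (f (idx n (t + 1))) w (S (t / n + 1)) (R (t / n + 1)) (z (t + 1) (idx n (t + 1)))
      ((omega n α (t + 1))⁻¹ • D (t + 1) (idx n (t + 1))) := by
  refine hrun.tracks_succ hf hsched hw ?_
  induction t with
  | zero => exact hrun.passInvariant_zero hI₀
  | succ t ih => exact hrun.passInvariant_succ hf hsched hw ih

end Run

end SLIQN

theorem lemma2 {d n : ℕ} [NeZero n] (hd : 0 < d)
    (f : Fin n → EuclideanSpace ℝ (Fin d) → ℝ) (μ L L' : ℝ) (hμ : 0 < μ)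
    (hf : ∀ i, ContDiff ℝ 2 (f i))
    (hconv : ∀ i, SLIQN.StrongConvexSmooth μ L (f i))
    (hlip : ∀ i, SLIQN.LipschitzHessian L' (f i))
    (xstar : EuclideanSpace ℝ (Fin d))
    (hxstar : IsMinOn (fun y => (1 / (n : ℝ)) * ∑ i, f i y) Set.univ xstar)
    (ρ : ℝ) (hρ0 : 0 < ρ) (hρ1 : ρ < 1 - μ / (d * L)) :
    ∃ ε > 0, ∃ σ₀ > 0,
      ∀ (I₀ : Fin n → Matrix (Fin d) (Fin d) ℝ) (x : ℕ → EuclideanSpace ℝ (Fin d))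
        (z : ℕ → Fin n → EuclideanSpace ℝ (Fin d)) (D : ℕ → Fin n → Matrix (Fin d) (Fin d) ℝ),
        ‖x 0 - xstar‖ ≤ ε →
        (∀ i, (I₀ i - SLIQN.hess (f i) (x 0)).PosSemidef) →
        (∀ i, SLIQN.sigma (I₀ i) (SLIQN.hess (f i) (x 0)) ≤ σ₀) →
        SLIQN.IsRun f (SLIQN.alpha μ L L' ε ρ) I₀ x z D →
        (∀ t : ℕ, ‖x t - xstar‖ ≤ ρ ^ ⌈(t : ℝ) / n⌉₊ * ‖x 0 - xstar‖) ∧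
        (∀ t : ℕ, 1 ≤ t →
          SLIQN.sigma
              ((SLIQN.omega n (SLIQN.alpha μ L L' ε ρ) t)⁻¹ • D t (SLIQN.idx n t))
              (SLIQN.hess (f (SLIQN.idx n t)) (z t (SLIQN.idx n t)))
            ≤ (1 - μ / (d * L)) ^ ⌈(t : ℝ) / n⌉₊ * SLIQN.delta d μ L L' ε ρ σ₀) := by
  have hμL : μ ≤ L := (hconv 0).le hd
  have hL' : 0 ≤ L' := (hlip 0).nonneg hd
  have hL : 0 < L := hμ.trans_le hμL
  have hreg (i : Fin n) : SLIQN.Regular μ L L' (f i) := ⟨hμ, hL, hL', hf i, hconv i, hlip i⟩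
  have hstar : ∑ i, ∇ (f i) xstar = 0 :=
    SLIQN.sum_gradient_eq_zero (fun i => (hf i).differentiable two_ne_zero xstar)
      (one_div_pos.2 (Nat.cast_pos.2 (NeZero.pos n))) hxstar
  have hρ : ρ < 1 := hρ1.trans_le (sub_le_self _ (by positivity))
  obtain ⟨ε, hε, hsmall⟩ := SLIQN.exists_radius d L L' (mul_pos hρ0 hμ)
  refine ⟨ε, hε, ε, hε, fun I₀ x z D hx0 hI₀ hσ hrun => ?_⟩
  have hsched := SLIQN.isSchedule_alpha hμ hμL hL' hρ0 hρ hρ1 hε.le hsmall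
    (norm_nonneg (x 0 - xstar)) hx0
  have htracks := hrun.tracks hreg hsched hstar fun i =>
    ⟨Matrix.le_iff.2 (hI₀ i), hσ i, by simp⟩
  refine ⟨?_, ?_⟩
  · rintro (_ | t)
    · simp
    · rw [SLIQN.ceil_succ_div, ← hrun.z_update _ t.succ_pos]
      exact (htracks t).norm_le
  · rintro (_ | t) ht
    · exact absurd ht one_pos.not_ge
    · rw [SLIQN.ceil_succ_div]
      exact (htracks t).sigma_le.trans (SLIQN.errorBound_alpha_le
        (SLIQN.selfConc_nonneg hμ.le hL') hε.le hρ0 hρ hρ1 hε.le _)
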